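/- Identify $so(3)$ with Euclidean space $E^3$ (Lie bracket = cross product) by $\mathrm{ad}(v)w=v\times w$, and give $SO(3)$ the bi-invariant metric for which $\mathrm{ad}$ is an isometry. A Riemannian cubic is a $C^\infty$ curve $x:[t_0,t_1]\to SO(3)$ with $\nabla_t^3x^{(1)}+R(\nabla_tx^{(1)},x^{(1)})x^{(1)}=0$; its Lie quadratic is its left Lie reduction $V$, $x^{(1)}(t)=x(t)\,\mathrm{ad}(V(t))$. In general a Lie quadratic is a $C^\infty$ curve $V:[t_0,t_1]\to E^3$ with $V^{(2)}=[V^{(1)},V]+C$ for some constant $C$. Let $t_0<t_1$, let $D\in E^3$ with $d:=\|D\|>0$, let $F_0=D/d$, and let $F_0,F_1,F_2$ be a positively oriented orthonormal basis. Put $\tilde e(t)=\exp(-d(t-t_0)\,\mathrm{ad}(F_0))$ and $\tilde i=\mathrm{ad}(F_0)$. Let $c_0,c_1,c_2,a_{01},a_{02},a_{11},a_{12},\gamma\in\mathbb R$, $\beta>0$, and $$A_0=a_{01}F_1+a_{02}F_2,\quad A_1=a_{11}F_1+a_{12}F_2,\quad B=\beta(\cos\gamma\,F_1+\sin\gamma\,F_2),\quad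 \rho=-\frac{2c_2}{d^2\beta}.$$ Let $V:[-1,1]\times[t_0,t_1]\to E^3$ be $C^\infty$, such that every $V_h=V(h,\cdot)$ is a Lie quadratic, $V_0=D$ is constant, and the initial data are affine in $h$: $$V_h(t_0)=D+h(c_0F_0+A_0+B),\quad V_h^{(1)}(t_0)=h(c_1F_0+A_1-d\,\tilde iB),\quad V_h^{(2)}(t_0)=h(2c_2F_0-d^2B).$$ For $n=1,2$ let $\hat V_n(t)=D+\sum_{i=1}^n\frac{\delta^i}{i!}\,\partial_h^iV(0,t)$. For linearly independent $X_1,X_2\in E^3$ let $S(X_1,X_2)\in SO(3)$ be the matrix with rows $$\frac{\|X_1\|^2X_2-\langle X_1,X_2\rangle X_1}{\|X_1\|\,r},\quad \frac{X_1\times X_2}{r},\quad \frac{X_1}{\|X_1\|},\qquad r=\sqrt{\|X_1\|^2\|X_2\|^2-\langle X_1,X_2\rangle^2},$$ let $T(W)(t)=S(W(t),W^{(1)}(t))$, and let $R_r=\begin{pmatrix}\cos r&\sin r&0\\-\sin r&\cos r&0\\0&0&1\end{pmatrix}$. Theorem. On $[t_0,t_1]$, for all real $\delta$, $$\hat V_1(t)=D+\delta\big((c_0+c_1(t-t_0)+c_2(t-t_0)^2)F_0+A_0+(t-t_0)A_1+\tilde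 e(t)B\big),$$ $$\hat V_2^{(2)}=\delta(2c_2F_0-d^2\tilde eB)+\frac{\delta^2}{2}(w+v),\qquad w=2d[A_0,\tilde i(\tilde e-1)B]+[A_1,2(\tilde e-1+d(t-t_0)\tilde i\tilde e)B],$$ $$v=-\frac{4c_2}{d}(\tilde e-1)A_0+\frac{4c_2}{d^2}\big(d(t-t_0)-\tilde i(\tilde e-1)\big)A_1+2\Big(2c_2(t-t_0)+d^2\Big(\frac{c_2(t-t_0)^3}{3}+\frac{c_1(t-t_0)^2}{2}+c_0(t-t_0)\Big)\Big)\tilde i\tilde eB.$$ Moreover there is $\delta_0\in(0,1]$ such that for all $\delta\in(0,\delta_0)$ the vectors $\hat V_2^{(2)}(t),\hat V_2^{(3)}(t)$ are linearly independent for every $t\in[t_0,t_1]$; and, for every Riemannian cubic $x_\delta:[t_0,t_1]\to SO(3)$ with Lie quadratic $V_\delta$, the curve $\hat x(t)=x_\delta(t_0)\,\hat y(t_0)^{\bf T}\,\hat y(t)$, where $\hat y(t)=R_{\hat\phi(t)}\,T(\hat V_2^{(2)})(t)$ and $$\hat\phi(t)=\delta(\rho^2+1)^{1/2}\Big((t-t_0)\beta+\frac{a_{11}(\cos(\gamma-d(t-t_0))-\cos\gamma)+a_{12}(\sin(\gamma-d(t-t_0))-\sin\gamma)}{d^2}\Big),$$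 is a $C^\infty$ curve in $SO(3)$ (given without any quadrature, by the formula for $\hat V_2^{(2)}$) that satisfies, for every $j\ge0$ and all $t\in[t_0,t_1]$, $$x_\delta^{(j)}(t)=\hat x^{(j)}(t)+O(\delta^2).$$ Here $\delta_0$ and the asymptotic constants depend only on $a_{11},a_{12},\beta,c_2,d,t_0,t_1$ and on a bound $M$ for $|c_0|,|c_1|,|a_{01}|,|a_{02}|$; the asymptotic constants depend also on $j$. -/

import Mathlib

open scoped Matrix ContDiff

namespace NearlyGeodesicCubic

/-- Euclidean 3-space, as a Lie algebra under the cross product, with inner product `⬝ᵥ`. -/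
abbrev E3 : Type := Fin 3 → ℝ

/-- Real `3 × 3` matrices, the ambient space of `SO(3)`. -/
abbrev M3 : Type := Matrix (Fin 3) (Fin 3) ℝ

/-- The Euclidean length of a vector of `E3`. -/
noncomputable def len (v : E3) : ℝ := Real.sqrt (v ⬝ᵥ v)

/-- The Lie isomorphism `ad : E3 → so(3)`, `ad v w = v ⨯₃ w`. -/
def ad (v : E3) : M3 := !![0, -v 2, v 1; v 2, 0, -v 0; -v 1, v 0, 0]

theorem ad_mulVec (v w : E3) : ad v *ᵥ w = v ⨯₃ w := by
  ext i
  fin_cases i <;> simp [ad, cross_apply, Matrix.mulVec, dotProduct, Fin.sum_univ_three] <;> ring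

/-! ### Riemannian cubics in bi-invariant `SO(3)` -/

/-- `x` restricts to a `C^∞` curve of `3 × 3` matrices on the set `I`. -/
def SmoothCurve (I : Set ℝ) (x : ℝ → M3) : Prop :=
  ∀ i k, ContDiffOn ℝ ∞ (fun s => x s i k) I

/-- The derivative within `I` of a curve of matrices, entry by entry. -/
noncomputable def curveDeriv (I : Set ℝ) (x : ℝ → M3) (t : ℝ) : M3 :=
  Matrix.of fun i k => derivWithin (fun s => x s i k) I t

/-- The projection of a matrix `m`, orthogonal for the inner product `tr (aᵀ b)`, to the
tangent space `{g * ξ | ξ skew}` of `SO(3)` at `g`. The restriction of (half of) this inner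
product to the tangent spaces is the bi-invariant metric of `SO(3)` for which `ad` is an
isometry. -/
noncomputable def tanProj (g m : M3) : M3 := (1 / 2 : ℝ) • (m - g * mᵀ * g)

/-- The Levi-Civita covariant derivative of a field `U` along the curve `x` in `SO(3)`: the
tangential part of the derivative of `U` in the ambient space. -/
noncomputable def covDeriv (I : Set ℝ) (x U : ℝ → M3) (t : ℝ) : M3 :=
  tanProj (x t) (curveDeriv I U t)

/-- The Levi-Civita connection on left-invariant fields, in the left trivialization. The
derivative of the field `g ↦ g * η` in the direction `g * ξ` is `g * (ξ * η)`, and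
its tangential part is `g * tanProj 1 (ξ * η)`. -/
noncomputable def leftConn (ξ η : M3) : M3 := tanProj 1 (ξ * η)

/-- The curvature `∇_ξ ∇_η ζ - ∇_η ∇_ξ ζ - ∇_[ξ,η] ζ` on left-invariant fields. -/
noncomputable def leftCurv (ξ η ζ : M3) : M3 :=
  leftConn ξ (leftConn η ζ) - leftConn η (leftConn ξ ζ) - leftConn (ξ * η - η * ξ) ζ

/-- The Riemannian curvature `R_g(X,Y)Z` of bi-invariant `SO(3)`, for `X, Y, Z` tangent at `g`. -/
noncomputable def curvature (g X Y Z : M3) : M3 :=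
  g * leftCurv (gᵀ * X) (gᵀ * Y) (gᵀ * Z)

/-- Riemannian cubics `x : [t₀,t₁] → SO(3)`: smooth solutions of the Euler-Lagrange equation
`∇³ x' + R(∇ x', x') x' = 0`. -/
def IsRiemannianCubic (t₀ t₁ : ℝ) (x : ℝ → M3) : Prop :=
  (∀ t ∈ Set.Icc t₀ t₁, x t ∈ Matrix.specialOrthogonalGroup (Fin 3) ℝ) ∧
  SmoothCurve (Set.Icc t₀ t₁) x ∧
  ∀ t ∈ Set.Icc t₀ t₁,
    covDeriv (Set.Icc t₀ t₁) x (covDeriv (Set.Icc t₀ t₁) x (covDeriv (Set.Icc t₀ t₁) x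
        (curveDeriv (Set.Icc t₀ t₁) x))) t
      + curvature (x t) (covDeriv (Set.Icc t₀ t₁) x (curveDeriv (Set.Icc t₀ t₁) x) t)
          (curveDeriv (Set.Icc t₀ t₁) x t) (curveDeriv (Set.Icc t₀ t₁) x t) = 0

/-- `V : [t₀,t₁] → E3 ≅ so(3)` is the left Lie reduction of `x : [t₀,t₁] → SO(3)`. -/
def IsLeftLieReduction (t₀ t₁ : ℝ) (x : ℝ → M3) (V : ℝ → E3) : Prop :=
  ∀ t ∈ Set.Icc t₀ t₁, (x t)⁻¹ * curveDeriv (Set.Icc t₀ t₁) x t = ad (V t)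

/-! ### Lie quadratics and their variations -/

/-- Lie quadratics `V : [t₀,t₁] → E3`: smooth solutions of `V'' = [V', V] + C`. -/
def IsLieQuadratic (t₀ t₁ : ℝ) (V : ℝ → E3) : Prop :=
  ContDiffOn ℝ ∞ V (Set.Icc t₀ t₁) ∧
  ∃ C : E3, ∀ t ∈ Set.Icc t₀ t₁,
    iteratedDerivWithin 2 V (Set.Icc t₀ t₁) t
      = derivWithin V (Set.Icc t₀ t₁) t ⨯₃ V t + C

/-- A smooth variation `V : [-1,1] × [t₀,t₁] → E3` through Lie quadratics of the constant
Lie quadratic `D`. -/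
def IsVariation (t₀ t₁ : ℝ) (D : E3) (V : ℝ → ℝ → E3) : Prop :=
  ContDiffOn ℝ ∞ (fun p : ℝ × ℝ => V p.1 p.2) (Set.Icc (-1) 1 ×ˢ Set.Icc t₀ t₁) ∧
  (∀ h ∈ Set.Icc (-1 : ℝ) 1, IsLieQuadratic t₀ t₁ (V h)) ∧
  ∀ t ∈ Set.Icc t₀ t₁, V 0 t = D

/-- The 2-jet at `t₀` of the variation `V` is affine in the variation parameter `h`, with
values `(D, 0, 0) + h (w₀, w₁, w₂)`. -/
def HasAffineInitialJet (t₀ t₁ : ℝ) (V : ℝ → ℝ → E3) (D w₀ w₁ w₂ : E3) : Prop :=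
  ∀ h ∈ Set.Icc (-1 : ℝ) 1,
    V h t₀ = D + h • w₀ ∧
    derivWithin (V h) (Set.Icc t₀ t₁) t₀ = h • w₁ ∧
    iteratedDerivWithin 2 (V h) (Set.Icc t₀ t₁) t₀ = h • w₂

/-- The `n`-th order approximate quadratic
`V₀(t) + ∑ i ∈ {1,…,n}, δ^i / i! * ∂^i V / ∂h^i (0,t)`. -/
noncomputable def approxQuadratic (V : ℝ → ℝ → E3) (n : ℕ) (δ t : ℝ) : E3 :=
  V 0 t + ∑ i ∈ Finset.Icc 1 n,
    (δ ^ i / (i.factorial : ℝ)) • iteratedDerivWithin i (fun h => V h t) (Set.Icc (-1) 1) 0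

/-- The rotation `exp (-θ ad F)` of `E3`, where `F` is a unit vector. -/
noncomputable def rot (F : E3) (θ : ℝ) (v : E3) : E3 :=
  (F ⬝ᵥ v) • F + Real.cos θ • (v - (F ⬝ᵥ v) • F) - Real.sin θ • (F ⨯₃ v)

/-- The first order variation `q F₀ + A₀ + (t - t₀) A₁ + exp (-d (t - t₀) ad F₀) B`, where
`q = c₀ + c₁ (t - t₀) + c₂ (t - t₀)²`. -/
noncomputable def firstVar (t₀ d c₀ c₁ c₂ : ℝ) (F₀ A₀ A₁ B : E3) (t : ℝ) : E3 :=
  (c₀ + c₁ * (t - t₀) + c₂ * (t - t₀) ^ 2) • F₀ + A₀ + (t - t₀) • A₁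
    + rot F₀ (d * (t - t₀)) B

/-- The function `f₂''`, the coefficient of `F₀` in the vector
`2 d [A₀, i (e - 1) B] + [A₁, 2 (e - 1 + d (t - t₀) i e) B]`, where
`e = exp (-d (t - t₀) ad F₀)` and `i = ad F₀`. -/
noncomputable def f2dd (t₀ d : ℝ) (F₀ A₀ A₁ B : E3) (t : ℝ) : ℝ :=
  F₀ ⬝ᵥ ((2 * d) • (A₀ ⨯₃ (F₀ ⨯₃ (rot F₀ (d * (t - t₀)) B - B)))
    + A₁ ⨯₃ ((2 : ℝ) • (rot F₀ (d * (t - t₀)) B - B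
        + (d * (t - t₀)) • (F₀ ⨯₃ rot F₀ (d * (t - t₀)) B))))

/-- The curve `v₂''` in the orthogonal complement of `F₀`, namely
`-(4 c₂ / d) (e - 1) A₀ + (4 c₂ / d²) (d (t - t₀) - i (e - 1)) A₁
  + 2 (2 c₂ (t - t₀) + d² I) i e B`, with `e` and `i` as in `f2dd` and
`I = c₂ (t - t₀)³ / 3 + c₁ (t - t₀)² / 2 + c₀ (t - t₀)`. -/
noncomputable def v2dd (t₀ d c₀ c₁ c₂ : ℝ) (F₀ A₀ A₁ B : E3) (t : ℝ) : E3 :=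
  (-(4 * c₂ / d)) • (rot F₀ (d * (t - t₀)) A₀ - A₀)
    + (4 * c₂ / d ^ 2) • ((d * (t - t₀)) • A₁ - F₀ ⨯₃ (rot F₀ (d * (t - t₀)) A₁ - A₁))
    + (2 * (2 * c₂ * (t - t₀)
        + d ^ 2 * (c₂ * (t - t₀) ^ 3 / 3 + c₁ * (t - t₀) ^ 2 / 2 + c₀ * (t - t₀))))
        • (F₀ ⨯₃ rot F₀ (d * (t - t₀)) B)

/-- The elementary closed form of the second derivative of the second order approximate
quadratic. -/
noncomputable def approxAccel (t₀ d c₀ c₁ c₂ : ℝ) (F₀ A₀ A₁ B : E3) (δ t : ℝ) : E3 :=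
  δ • ((2 * c₂) • F₀ - d ^ 2 • rot F₀ (d * (t - t₀)) B)
    + (δ ^ 2 / 2) • (f2dd t₀ d F₀ A₀ A₁ B t • F₀ + v2dd t₀ d c₀ c₁ c₂ F₀ A₀ A₁ B t)

/-! ### The approximation of the cubic -/

/-- Clockwise rotation by `r` of the first two coordinates. -/
noncomputable def R (r : ℝ) : M3 :=
  !![Real.cos r, Real.sin r, 0; -Real.sin r, Real.cos r, 0; 0, 0, 1]

/-- The area `√(‖X₁‖² ‖X₂‖² - ⟨X₁,X₂⟩²)` of the parallelogram spanned by `X₁, X₂`. -/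
noncomputable def area (X₁ X₂ : E3) : ℝ :=
  Real.sqrt (len X₁ ^ 2 * len X₂ ^ 2 - (X₁ ⬝ᵥ X₂) ^ 2)

/-- For linearly independent `X₁, X₂`, the element of `SO(3)` whose rows are
`X₂ - ⟨X₁,X₂⟩ X₁ / ‖X₁‖²` normalized, `X₁ × X₂` normalized, and `X₁` normalized. -/
noncomputable def S (X₁ X₂ : E3) : M3 :=
  Matrix.of ![(1 / (len X₁ * area X₁ X₂)) • (len X₁ ^ 2 • X₂ - (X₁ ⬝ᵥ X₂) • X₁),
    (1 / area X₁ X₂) • (X₁ ⨯₃ X₂),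
    (1 / len X₁) • X₁]

/-- `T(W)(t) = S(W(t), W'(t))` for a curve `W` on `[t₀,t₁]`. -/
noncomputable def T (t₀ t₁ : ℝ) (W : ℝ → E3) (t : ℝ) : M3 :=
  S (W t) (derivWithin W (Set.Icc t₀ t₁) t)

/-- The approximate phase, where `ρ = -2 c₂ / (d² β)`. -/
noncomputable def phase (t₀ d a₁₁ a₁₂ β γ c₂ δ t : ℝ) : ℝ :=
  δ * Real.sqrt ((-2 * c₂ / (d ^ 2 * β)) ^ 2 + 1) *
    ((t - t₀) * β
      + (a₁₁ * (Real.cos (γ - d * (t - t₀)) - Real.cos γ)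
          + a₁₂ * (Real.sin (γ - d * (t - t₀)) - Real.sin γ)) / d ^ 2)

/-- The second derivative of the second order approximate quadratic on `[t₀,t₁]`. -/
noncomputable def accel2 (t₀ t₁ : ℝ) (V : ℝ → ℝ → E3) (δ : ℝ) : ℝ → E3 :=
  iteratedDerivWithin 2 (approxQuadratic V 2 δ) (Set.Icc t₀ t₁)

/-- The curve `ŷ = R_φ ∘ T(V̂₂'')`, for a phase `φ`. -/
noncomputable def yHat (t₀ t₁ : ℝ) (V : ℝ → ℝ → E3) (δ : ℝ) (φ : ℝ → ℝ) (t : ℝ) : M3 :=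
  R (φ t) * T t₀ t₁ (accel2 t₀ t₁ V δ) t

/-- The curve `x̂(t) = x(t₀) ŷ(t₀)ᵀ ŷ(t)`. -/
noncomputable def xHat (t₀ t₁ : ℝ) (V : ℝ → ℝ → E3) (δ : ℝ) (φ : ℝ → ℝ) (x : ℝ → M3)
    (t : ℝ) : M3 :=
  x t₀ * (yHat t₀ t₁ V δ φ t₀)ᵀ * yHat t₀ t₁ V δ φ t

end NearlyGeodesicCubic

/-!
All Lie quadratics, frames and cubics below are treated as families indexed by all the admissible
data at once, and estimates are stated as `BigO`: a family of functions on `[t₀,t₁]` is `O(ε ^ k)`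
together with all derivatives, uniformly in the index. Such families form a graded algebra, closed
under derivatives, under inverses and square roots of families bounded away from `0`, and under
solving linear differential equations (`VBigO.of_linear_ode`). This yields the uniform constants
and all orders of differentiation simultaneously. Here `ε = |h|`.

*The variations.* A Lie quadratic satisfies `V''' = V'' × V`, so `‖V''‖` is constant; hence
`V''`, `V'` and `V - D` are `O(h)`. Comparing `V''' = V'' × V` with its linearizations gives
`V'' = h W + (h² / 2) Y + O(h³)` (`vBigO_V''_sub_Y`), where `W` is the second derivative of the
first variation and `Y` is the explicit solution of `Y' = Y × D + 2 W × U`, `Y(t₀) = 0`, with `U`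
the first variation. Integrating twice and using uniqueness of Taylor coefficients in `h`
identifies the first two variations (`Datum.variation_eq`) without exchanging partial derivatives.

*The frame.* Let `w = W + (h / 2) Y`. The frame `R φ * S w w'` has the left Lie reduction
`Ω = -(w × w') / ‖w‖² - (φ' / ‖w‖ + ⟨w'', w × w'⟩ / ‖w × w'‖²) w`
(`hasMatrixDerivWithinAt_frame`). Since `w' = w × V + O(h²)`, the vector `Ω - V` is, up to
`O(h²)`, the multiple of `w` by `-(φ' / ‖w‖ + ⟨V', w'⟩ / ‖w'‖²)`. Its first order part vanishes
because of the choice of the phase (`Datum.phaseRate_mul`), so `Ω = V + O(h²)`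
(`Datum.vBigO_frameVelocity_sub`).

*The cubic.* Two curves in `SO(3)` with equal initial values whose left Lie reductions agree up to
`O(h²)` agree up to `O(h²)` (`bigO_sub_of_reduction`). Of the cubic itself only its left Lie
reduction is used.
-/

namespace NearlyGeodesicCubic

/-! ### Families of functions of order `ε ^ k`, uniformly with all derivatives -/

/-- The family `f` of functions on `I` is `O(ε ^ k)` together with its first `n` derivatives
within `I`, with constants that do not depend on the index `p`. The derivative is carried as a
witness, which makes closure properties inductive in `n`. -/
def BigOUpTo {ι : Type*} (I : Set ℝ) (ε : ι → ℝ) (k : ℕ) : ℕ → (ι → ℝ → ℝ) → Prop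
  | 0, f => ∃ K, ∀ p, ∀ t ∈ I, |f p t| ≤ K * ε p ^ k
  | n + 1, f => (∃ K, ∀ p, ∀ t ∈ I, |f p t| ≤ K * ε p ^ k) ∧
      ∃ f' : ι → ℝ → ℝ, (∀ p, ∀ t ∈ I, HasDerivWithinAt (f p) (f' p t) I t) ∧
        BigOUpTo I ε k n f'

/-- The family `f` of functions on `I` is `O(ε ^ k)` with all its derivatives, uniformly in the
index. -/
def BigO {ι : Type*} (I : Set ℝ) (ε : ι → ℝ) (k : ℕ) (f : ι → ℝ → ℝ) : Prop :=
  ∀ n, BigOUpTo I ε k n f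

section Calculus

variable {ι : Type*} {I : Set ℝ} {ε : ι → ℝ} {k l n : ℕ} {f g : ι → ℝ → ℝ}

namespace BigOUpTo

theorem bound (h : BigOUpTo I ε k n f) : ∃ K, ∀ p, ∀ t ∈ I, |f p t| ≤ K * ε p ^ k := by
  cases n with
  | zero => exact h
  | succ n => exact h.1

theorem of_succ (h : BigOUpTo I ε k (n + 1) f) : BigOUpTo I ε k n f := by
  induction n generalizing f with
  | zero => exact h.1
  | succ n ih =>
    obtain ⟨hb, f', hf', hn⟩ := h
    exact ⟨hb, f', hf', ih hn⟩

theorem congr (h : BigOUpTo I ε k n f) (hfg : ∀ p, ∀ t ∈ I, g p t = f p t) :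
    BigOUpTo I ε k n g := by
  cases n with
  | zero =>
    obtain ⟨K, hK⟩ := h
    exact ⟨K, fun p t ht => by rw [hfg p t ht]; exact hK p t ht⟩
  | succ n =>
    obtain ⟨⟨K, hK⟩, f', hf', hn⟩ := h
    exact ⟨⟨K, fun p t ht => by rw [hfg p t ht]; exact hK p t ht⟩, f',
      fun p t ht => (hf' p t ht).congr (hfg p) (hfg p t ht), hn⟩

theorem reindex {κ : Type*} (φ : κ → ι) (h : BigOUpTo I ε k n f) :
    BigOUpTo I (fun q => ε (φ q)) k n (fun q => f (φ q)) := by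
  induction n generalizing f with
  | zero =>
    obtain ⟨K, hK⟩ := h
    exact ⟨K, fun q => hK (φ q)⟩
  | succ n ih =>
    obtain ⟨⟨K, hK⟩, f', hf', hn⟩ := h
    exact ⟨⟨K, fun q => hK (φ q)⟩, fun q => f' (φ q), fun q => hf' (φ q), ih hn⟩

theorem weaken (hε : ∀ p, 0 ≤ ε p ∧ ε p ≤ 1) (hlk : l ≤ k) (h : BigOUpTo I ε k n f) :
    BigOUpTo I ε l n f := by
  have key : ∀ f : ι → ℝ → ℝ, (∃ K, ∀ p, ∀ t ∈ I, |f p t| ≤ K * ε p ^ k) →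
      ∃ K, ∀ p, ∀ t ∈ I, |f p t| ≤ K * ε p ^ l := by
    rintro f ⟨K, hK⟩
    refine ⟨|K|, fun p t ht => (hK p t ht).trans ?_⟩
    exact mul_le_mul (le_abs_self K) (pow_le_pow_of_le_one (hε p).1 (hε p).2 hlk)
      (pow_nonneg (hε p).1 _) (abs_nonneg _)
  induction n generalizing f with
  | zero => exact key f h
  | succ n ih =>
    obtain ⟨hb, f', hf', hn⟩ := h
    exact ⟨key f hb, f', hf', ih hn⟩

theorem zero : BigOUpTo I ε k n (fun _ _ => 0) := by
  induction n with
  | zero => exact ⟨0, by simp⟩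
  | succ n ih =>
    exact ⟨⟨0, by simp⟩, fun _ _ => 0, fun p t _ => hasDerivWithinAt_const _ _ _, ih⟩

theorem const {c : ι → ℝ} {K : ℝ} (hc : ∀ p, |c p| ≤ K * ε p ^ k) :
    BigOUpTo I ε k n (fun p _ => c p) := by
  cases n with
  | zero => exact ⟨K, fun p t _ => hc p⟩
  | succ n =>
    exact ⟨⟨K, fun p t _ => hc p⟩, fun _ _ => 0, fun p t _ => hasDerivWithinAt_const _ _ _, zero⟩

theorem bound_add (hf : BigOUpTo I ε k n f) (hg : BigOUpTo I ε k n g) :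
    ∃ K, ∀ p, ∀ t ∈ I, |f p t + g p t| ≤ K * ε p ^ k := by
  obtain ⟨K, hK⟩ := hf.bound
  obtain ⟨L, hL⟩ := hg.bound
  refine ⟨K + L, fun p t ht => (abs_add_le _ _).trans ?_⟩
  have := add_le_add (hK p t ht) (hL p t ht)
  linarith

theorem add (hf : BigOUpTo I ε k n f) (hg : BigOUpTo I ε k n g) :
    BigOUpTo I ε k n (fun p t => f p t + g p t) := by
  induction n generalizing f g with
  | zero => exact bound_add hf hg
  | succ n ih =>
    obtain ⟨_, f', hf', hn⟩ := id hf
    obtain ⟨_, g', hg', hm⟩ := id hg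
    exact ⟨bound_add hf hg, _, fun p t ht => (hf' p t ht).fun_add (hg' p t ht), ih hn hm⟩

theorem bound_mul (hf : BigOUpTo I ε k n f) (hg : BigOUpTo I ε l n g) :
    ∃ K, ∀ p, ∀ t ∈ I, |f p t * g p t| ≤ K * ε p ^ (k + l) := by
  obtain ⟨K, hK⟩ := hf.bound
  obtain ⟨L, hL⟩ := hg.bound
  refine ⟨K * L, fun p t ht => ?_⟩
  rw [abs_mul]
  calc |f p t| * |g p t| ≤ (K * ε p ^ k) * (L * ε p ^ l) :=
        mul_le_mul (hK p t ht) (hL p t ht) (abs_nonneg _) ((abs_nonneg _).trans (hK p t ht))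
    _ = _ := by rw [pow_add]; ring

theorem mul (hf : BigOUpTo I ε k n f) (hg : BigOUpTo I ε l n g) :
    BigOUpTo I ε (k + l) n (fun p t => f p t * g p t) := by
  induction n generalizing f g with
  | zero => exact bound_mul hf hg
  | succ n ih =>
    obtain ⟨_, f', hf', hn⟩ := id hf
    obtain ⟨_, g', hg', hm⟩ := id hg
    exact ⟨bound_mul hf hg, _, fun p t ht => (hf' p t ht).fun_mul (hg' p t ht),
      (ih hn hg.of_succ).add (ih hf.of_succ hm)⟩

theorem inv {c : ℝ} (hc : 0 < c) (hfc : ∀ p, ∀ t ∈ I, c ≤ f p t) (hf : BigOUpTo I ε 0 n f) :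
    BigOUpTo I ε 0 n (fun p t => (f p t)⁻¹) := by
  have key : ∃ K, ∀ p, ∀ t ∈ I, |(f p t)⁻¹| ≤ K * ε p ^ 0 := by
    refine ⟨c⁻¹, fun p t ht => ?_⟩
    have h := hfc p t ht
    rw [abs_inv, abs_of_pos (hc.trans_le h), pow_zero, mul_one]
    exact inv_anti₀ hc h
  induction n with
  | zero => exact key
  | succ n ih =>
    have hi := ih hf.of_succ
    obtain ⟨_, f', hf', hn⟩ := id hf
    refine ⟨key, fun p t => ((-1) * f' p t) * ((f p t)⁻¹ * (f p t)⁻¹), fun p t ht => ?_, ?_⟩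
    · have h0 : f p t ≠ 0 := (hc.trans_le (hfc p t ht)).ne'
      exact ((hf' p t ht).fun_inv h0).congr_deriv (by field_simp)
    · exact ((BigOUpTo.const (k := 0) (K := 1) (c := fun _ => -1) (by simp)).mul hn).mul
        (hi.mul hi)

theorem sqrt {c : ℝ} (hc : 0 < c) (hfc : ∀ p, ∀ t ∈ I, c ≤ f p t) (hf : BigOUpTo I ε 0 n f) :
    BigOUpTo I ε 0 n (fun p t => Real.sqrt (f p t)) := by
  have key : ∃ K, ∀ p, ∀ t ∈ I, |Real.sqrt (f p t)| ≤ K * ε p ^ 0 := by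
    obtain ⟨K, hK⟩ := hf.bound
    refine ⟨Real.sqrt K, fun p t ht => ?_⟩
    have h := hK p t ht
    rw [pow_zero, mul_one] at h ⊢
    rw [abs_of_nonneg (Real.sqrt_nonneg _)]
    exact Real.sqrt_le_sqrt ((le_abs_self _).trans h)
  induction n with
  | zero => exact key
  | succ n ih =>
    have hi := ih hf.of_succ
    obtain ⟨_, f', hf', hn⟩ := id hf
    have hi' := hi.inv (Real.sqrt_pos.2 hc) fun p t ht => Real.sqrt_le_sqrt (hfc p t ht)
    refine ⟨key, fun p t => (1 / 2 * f' p t) * (Real.sqrt (f p t))⁻¹, fun p t ht => ?_, ?_⟩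
    · have h0 : f p t ≠ 0 := (hc.trans_le (hfc p t ht)).ne'
      refine ((hf' p t ht).sqrt h0).congr_deriv ?_
      have : Real.sqrt (f p t) ≠ 0 := (Real.sqrt_pos.2 (hc.trans_le (hfc p t ht))).ne'
      field_simp
    · exact ((BigOUpTo.const (k := 0) (K := 1 / 2) (c := fun _ => 1 / 2)
        (by intro; norm_num)).mul hn).mul hi'

theorem contDiffOn (hI : UniqueDiffOn ℝ I) (h : BigOUpTo I ε k (n + 1) f) (p : ι) :
    ContDiffOn ℝ n (f p) I := by
  induction n generalizing f with
  | zero =>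
    obtain ⟨_, f', hf', -⟩ := h
    exact contDiffOn_zero.2 fun t ht => (hf' p t ht).continuousWithinAt
  | succ n ih =>
    obtain ⟨_, f', hf', hn⟩ := h
    push_cast
    rw [contDiffOn_succ_iff_derivWithin hI]
    refine ⟨fun t ht => (hf' p t ht).differentiableWithinAt, by simp, ?_⟩
    exact (ih hn).congr fun t ht => (hf' p t ht).derivWithin (hI t ht)

theorem iteratedDerivWithin_bound (hI : UniqueDiffOn ℝ I) (h : BigOUpTo I ε k n f) :
    ∃ K, ∀ p, ∀ t ∈ I, |iteratedDerivWithin n (f p) I t| ≤ K * ε p ^ k := by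
  induction n generalizing f with
  | zero => simpa [BigOUpTo] using h
  | succ n ih =>
    obtain ⟨_, f', hf', hn⟩ := h
    obtain ⟨K, hK⟩ := ih hn
    refine ⟨K, fun p t ht => ?_⟩
    rw [iteratedDerivWithin_succ',
      iteratedDerivWithin_congr (fun s hs => (hf' p s hs).derivWithin (hI s hs)) ht]
    exact hK p t ht

/-- A family with small initial values and small derivatives is small. -/
theorem of_deriv {t₀ t₁ : ℝ} {f' : ι → ℝ → ℝ} (ht : t₀ ≤ t₁)
    (h0 : ∃ K, ∀ p, |f p t₀| ≤ K * ε p ^ k)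
    (hf' : ∀ p, ∀ t ∈ Set.Icc t₀ t₁, HasDerivWithinAt (f p) (f' p t) (Set.Icc t₀ t₁) t)
    (h : BigOUpTo (Set.Icc t₀ t₁) ε k n f') : BigOUpTo (Set.Icc t₀ t₁) ε k n f := by
  refine of_succ ⟨?_, f', hf', h⟩
  obtain ⟨K, hK⟩ := h0
  obtain ⟨L, hL⟩ := h.bound
  refine ⟨K + L * (t₁ - t₀), fun p t htI => ?_⟩
  have ht0 : t₀ ∈ Set.Icc t₀ t₁ := ⟨le_rfl, ht⟩
  have h1 := Convex.norm_image_sub_le_of_norm_hasDerivWithin_le (C := L * ε p ^ k)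
    (hf' p) (fun s hs => hL p s hs) (convex_Icc t₀ t₁) ht0 htI
  simp only [Real.norm_eq_abs] at h1
  have h2 : |t - t₀| ≤ t₁ - t₀ := by
    rw [abs_of_nonneg (by linarith [htI.1])]; linarith [htI.2]
  have h3 : 0 ≤ L * ε p ^ k := (abs_nonneg _).trans (hL p t₀ ht0)
  have h4 := mul_le_mul_of_nonneg_left h2 h3
  have h5 : |f p t| ≤ |f p t - f p t₀| + |f p t₀| := by
    simpa using abs_add_le (f p t - f p t₀) (f p t₀)
  have h6 := hK p
  linarith

theorem neg (hf : BigOUpTo I ε k n f) : BigOUpTo I ε k n (fun p t => -f p t) := by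
  simpa using (BigOUpTo.const (k := 0) (K := 1) (c := fun _ => -1) (by simp)).mul hf

theorem sub (hf : BigOUpTo I ε k n f) (hg : BigOUpTo I ε k n g) :
    BigOUpTo I ε k n (fun p t => f p t - g p t) := by
  simpa only [sub_eq_add_neg] using hf.add hg.neg

theorem cross {u v : ι → ℝ → E3} (hu : ∀ i, BigOUpTo I ε k n (fun p t => u p t i))
    (hv : ∀ i, BigOUpTo I ε l n (fun p t => v p t i)) (i : Fin 3) :
    BigOUpTo I ε (k + l) n (fun p t => (u p t ⨯₃ v p t) i) := by
  fin_cases i <;> simp only [cross_apply] <;>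
    exact ((hu _).mul (hv _)).sub ((hu _).mul (hv _))

end BigOUpTo

namespace BigO

theorem congr (h : BigO I ε k f) (hfg : ∀ p, ∀ t ∈ I, g p t = f p t) : BigO I ε k g :=
  fun n => (h n).congr hfg

theorem reindex {κ : Type*} (φ : κ → ι) (h : BigO I ε k f) :
    BigO I (fun q => ε (φ q)) k (fun q => f (φ q)) := fun n => (h n).reindex φ

theorem weaken (hε : ∀ p, 0 ≤ ε p ∧ ε p ≤ 1) (hlk : l ≤ k) (h : BigO I ε k f) :
    BigO I ε l f := fun n => (h n).weaken hε hlk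

theorem const {c : ι → ℝ} {K : ℝ} (hc : ∀ p, |c p| ≤ K * ε p ^ k) :
    BigO I ε k (fun p _ => c p) := fun _ => BigOUpTo.const hc

theorem real (a : ℝ) : BigO I ε 0 (fun _ _ => a) :=
  BigO.const (K := |a|) (by simp)

theorem add (hf : BigO I ε k f) (hg : BigO I ε k g) : BigO I ε k (fun p t => f p t + g p t) :=
  fun n => (hf n).add (hg n)

theorem mul (hf : BigO I ε k f) (hg : BigO I ε l g) :
    BigO I ε (k + l) (fun p t => f p t * g p t) :=
  fun n => (hf n).mul (hg n)

theorem mul_zero_right (hf : BigO I ε k f) (hg : BigO I ε 0 g) :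
    BigO I ε k (fun p t => f p t * g p t) := hf.mul hg

theorem mul_zero_left (hf : BigO I ε 0 f) (hg : BigO I ε k g) :
    BigO I ε k (fun p t => f p t * g p t) := by
  simpa only [Nat.zero_add] using hf.mul hg

theorem neg (hf : BigO I ε k f) : BigO I ε k (fun p t => -f p t) :=
  fun n => (hf n).neg

theorem sub (hf : BigO I ε k f) (hg : BigO I ε k g) : BigO I ε k (fun p t => f p t - g p t) :=
  fun n => (hf n).sub (hg n)

theorem inv {c : ℝ} (hc : 0 < c) (hfc : ∀ p, ∀ t ∈ I, c ≤ f p t) (hf : BigO I ε 0 f) :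
    BigO I ε 0 (fun p t => (f p t)⁻¹) := fun n => (hf n).inv hc hfc

theorem sqrt {c : ℝ} (hc : 0 < c) (hfc : ∀ p, ∀ t ∈ I, c ≤ f p t) (hf : BigO I ε 0 f) :
    BigO I ε 0 (fun p t => Real.sqrt (f p t)) := fun n => (hf n).sqrt hc hfc

theorem bound (h : BigO I ε k f) : ∃ K, ∀ p, ∀ t ∈ I, |f p t| ≤ K * ε p ^ k := h 0

theorem deriv (hI : UniqueDiffOn ℝ I) {f' : ι → ℝ → ℝ}
    (hf' : ∀ p, ∀ t ∈ I, HasDerivWithinAt (f p) (f' p t) I t) (h : BigO I ε k f) :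
    BigO I ε k f' := by
  intro n
  obtain ⟨_, g, hg, hn⟩ := h (n + 1)
  exact hn.congr fun p t ht => (hI t ht).eq_deriv _ (hf' p t ht) (hg p t ht)

theorem contDiffOn (hI : UniqueDiffOn ℝ I) (h : BigO I ε k f) (p : ι) :
    ContDiffOn ℝ ∞ (f p) I :=
  contDiffOn_infty.2 fun n => (h (n + 1)).contDiffOn hI p

theorem of_deriv {t₀ t₁ : ℝ} {f' : ι → ℝ → ℝ} (ht : t₀ ≤ t₁)
    (h0 : ∃ K, ∀ p, |f p t₀| ≤ K * ε p ^ k)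
    (hf' : ∀ p, ∀ t ∈ Set.Icc t₀ t₁, HasDerivWithinAt (f p) (f' p t) (Set.Icc t₀ t₁) t)
    (h : BigO (Set.Icc t₀ t₁) ε k f') : BigO (Set.Icc t₀ t₁) ε k f :=
  fun n => (h n).of_deriv ht h0 hf'

/-- Bootstrapping: for a system that is bounded and whose derivatives inherit the regularity of
the system, all derivatives are bounded. -/
theorem of_bootstrap {J : Type*} {f f' : J → ι → ℝ → ℝ}
    (hb : ∀ j, ∃ K, ∀ p, ∀ t ∈ I, |f j p t| ≤ K * ε p ^ k)
    (hf' : ∀ j p, ∀ t ∈ I, HasDerivWithinAt (f j p) (f' j p t) I t)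
    (step : ∀ n, (∀ j, BigOUpTo I ε k n (f j)) → ∀ j, BigOUpTo I ε k n (f' j)) (j : J) :
    BigO I ε k (f j) := by
  intro n
  induction n generalizing j with
  | zero => exact hb j
  | succ n ih => exact ⟨hb j, f' j, hf' j, step n ih j⟩

end BigO

/-! ### Vector-valued families -/

/-- A family of curves in `E3` all of whose coordinates are `O(ε ^ k)`. -/
def VBigO (I : Set ℝ) (ε : ι → ℝ) (k : ℕ) (f : ι → ℝ → E3) : Prop :=
  ∀ i, BigO I ε k (fun p t => f p t i)

namespace VBigO

variable {u v : ι → ℝ → E3}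

theorem congr (h : VBigO I ε k u) (huv : ∀ p, ∀ t ∈ I, v p t = u p t) : VBigO I ε k v :=
  fun i => (h i).congr fun p t ht => by rw [huv p t ht]

theorem reindex {κ : Type*} (φ : κ → ι) (h : VBigO I ε k u) :
    VBigO I (fun q => ε (φ q)) k (fun q => u (φ q)) := fun i => (h i).reindex φ

theorem weaken (hε : ∀ p, 0 ≤ ε p ∧ ε p ≤ 1) (hlk : l ≤ k) (h : VBigO I ε k u) :
    VBigO I ε l u := fun i => (h i).weaken hε hlk

theorem add (hu : VBigO I ε k u) (hv : VBigO I ε k v) :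
    VBigO I ε k (fun p t => u p t + v p t) := fun i => (hu i).add (hv i)

theorem sub (hu : VBigO I ε k u) (hv : VBigO I ε k v) :
    VBigO I ε k (fun p t => u p t - v p t) := fun i => (hu i).sub (hv i)

theorem smul (hf : BigO I ε k f) (hv : VBigO I ε l v) :
    VBigO I ε (k + l) (fun p t => f p t • v p t) := fun i => hf.mul (hv i)

theorem smul_zero_left (hf : BigO I ε 0 f) (hv : VBigO I ε k v) :
    VBigO I ε k (fun p t => f p t • v p t) := fun i => hf.mul_zero_left (hv i)

theorem cross (hu : VBigO I ε k u) (hv : VBigO I ε l v) :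
    VBigO I ε (k + l) (fun p t => u p t ⨯₃ v p t) :=
  fun i n => BigOUpTo.cross (fun i => hu i n) (fun i => hv i n) i

theorem dot (hu : VBigO I ε k u) (hv : VBigO I ε l v) :
    BigO I ε (k + l) (fun p t => u p t ⬝ᵥ v p t) := by
  simp only [dotProduct, Fin.sum_univ_three]
  exact (((hu _).mul (hv _)).add ((hu _).mul (hv _))).add ((hu _).mul (hv _))

theorem cross_zero_left (hu : VBigO I ε 0 u) (hv : VBigO I ε k v) :
    VBigO I ε k (fun p t => u p t ⨯₃ v p t) := by
  simpa only [Nat.zero_add] using hu.cross hv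

theorem dot_zero_left (hu : VBigO I ε 0 u) (hv : VBigO I ε k v) :
    BigO I ε k (fun p t => u p t ⬝ᵥ v p t) := by
  simpa only [Nat.zero_add] using hu.dot hv

theorem deriv (hI : UniqueDiffOn ℝ I) {u' : ι → ℝ → E3}
    (hu' : ∀ p, ∀ t ∈ I, HasDerivWithinAt (u p) (u' p t) I t) (h : VBigO I ε k u) :
    VBigO I ε k u' :=
  fun i => (h i).deriv hI fun p t ht => hasDerivWithinAt_pi.1 (hu' p t ht) i

theorem of_deriv {t₀ t₁ : ℝ} {u' : ι → ℝ → E3} (ht : t₀ ≤ t₁)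
    (h0 : ∃ K, ∀ p i, |u p t₀ i| ≤ K * ε p ^ k)
    (hu' : ∀ p, ∀ t ∈ Set.Icc t₀ t₁, HasDerivWithinAt (u p) (u' p t) (Set.Icc t₀ t₁) t)
    (h : VBigO (Set.Icc t₀ t₁) ε k u') : VBigO (Set.Icc t₀ t₁) ε k u := by
  obtain ⟨K, hK⟩ := h0
  exact fun i => BigO.of_deriv ht ⟨K, fun p => hK p i⟩
    (fun p t ht => hasDerivWithinAt_pi.1 (hu' p t ht) i) (h i)

theorem norm_bound (hε : ∀ p, 0 ≤ ε p) (h : VBigO I ε k u) :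
    ∃ K, ∀ p, ∀ t ∈ I, ‖u p t‖ ≤ K * ε p ^ k := by
  have h' := fun i => (h i).bound
  choose K hK using h'
  refine ⟨∑ i, |K i|, fun p t ht => ?_⟩
  have hp : 0 ≤ ε p ^ k := pow_nonneg (hε p) k
  refine (pi_norm_le_iff_of_nonneg (by positivity)).2 fun i => (hK i p t ht).trans ?_
  refine mul_le_mul_of_nonneg_right ((le_abs_self _).trans ?_) hp
  exact Finset.single_le_sum (f := fun i => |K i|) (fun _ _ => abs_nonneg _) (Finset.mem_univ i)

/-- A solution of `g' = r + g × c` that starts at `0` is as small as the inhomogeneity `r`. -/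
theorem of_linear_ode {t₀ t₁ : ℝ} {g r : ι → ℝ → E3} {c : ι → E3}
    (hε : ∀ p, 0 ≤ ε p) {N : ℝ} (hN : 0 < N) (hc : ∀ p i, |c p i| ≤ N)
    (h0 : ∀ p, g p t₀ = 0)
    (hg : ∀ p, ∀ t ∈ Set.Icc t₀ t₁,
      HasDerivWithinAt (g p) (r p t + g p t ⨯₃ c p) (Set.Icc t₀ t₁) t)
    (hr : VBigO (Set.Icc t₀ t₁) ε k r) : VBigO (Set.Icc t₀ t₁) ε k g := by
  obtain ⟨K, hK⟩ := hr.norm_bound hε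
  refine BigO.of_bootstrap (f := fun i p t => g p t i)
    (f' := fun i p t => (r p t + g p t ⨯₃ c p) i) (fun i => ?_)
    (fun i p t ht => hasDerivWithinAt_pi.1 (hg p t ht) i) fun n hn i => ?_
  · refine ⟨K / (2 * N) * (Real.exp (2 * N * (t₁ - t₀)) - 1), fun p t htI => ?_⟩
    have hb := norm_le_gronwallBound_of_norm_deriv_right_le (f := g p)
      (f' := fun t => r p t + g p t ⨯₃ c p) (δ := 0) (K := 2 * N) (ε := K * ε p ^ k)
      (a := t₀) (b := t₁) (fun t ht => (hg p t ht).continuousWithinAt)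
      (fun t ht => (hg p t ⟨ht.1, ht.2.le⟩).mono_of_mem_nhdsWithin
        (Icc_mem_nhdsGE_of_mem ht)) (by simp [h0]) (fun t ht => ?_) t htI
    · refine (norm_le_pi_norm (g p t) i).trans (hb.trans ?_)
      rw [gronwallBound_of_K_ne_0 (by positivity)]
      have hKε : 0 ≤ K * ε p ^ k := (norm_nonneg _).trans (hK p t htI)
      have : Real.exp (2 * N * (t - t₀)) ≤ Real.exp (2 * N * (t₁ - t₀)) :=
        Real.exp_le_exp.2 (mul_le_mul_of_nonneg_left (by linarith [htI.2]) (by positivity))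
      have := mul_le_mul_of_nonneg_left (sub_le_sub_right this 1)
        (div_nonneg hKε (by positivity : 0 ≤ 2 * N))
      calc _ ≤ _ := by simpa using this
        _ = _ := by ring
    · refine (norm_add_le _ _).trans ?_
      rw [add_comm]
      refine add_le_add ?_ (hK p t ⟨ht.1, ht.2.le⟩)
      refine (pi_norm_le_iff_of_nonneg (by positivity)).2 fun i => ?_
      have h1 : ∀ i j, |g p t i * c p j| ≤ N * ‖g p t‖ := fun i j => by
        rw [abs_mul, mul_comm]
        exact mul_le_mul (hc p j) (norm_le_pi_norm (g p t) i) (abs_nonneg _) hN.le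
      fin_cases i <;> simp only [cross_apply, Real.norm_eq_abs] <;>
        exact (abs_sub _ _).trans ((add_le_add (h1 _ _) (h1 _ _)).trans (by linarith))
  · exact (hr i n).add (BigOUpTo.cross (l := 0) hn
      (fun i => BigOUpTo.const (K := N) (by simpa using fun p => hc p i)) i)

end VBigO

end Calculus

/-! ### Coordinates in an orthonormal frame -/

/-- The vector with coordinates `x, y, z` in the frame `F₀, F₁, F₀ × F₁`. -/
def frame (F₀ F₁ : E3) (x y z : ℝ) : E3 := x • F₀ + y • F₁ + z • (F₀ ⨯₃ F₁)

theorem len_eq_one_iff {v : E3} : len v = 1 ↔ v ⬝ᵥ v = 1 := by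
  rw [len, Real.sqrt_eq_one]

theorem dot_self_nonneg (v : E3) : 0 ≤ v ⬝ᵥ v := by
  simp only [dotProduct, Fin.sum_univ_three]
  nlinarith [mul_self_nonneg (v 0), mul_self_nonneg (v 1), mul_self_nonneg (v 2)]

theorem sq_apply_le_dot_self (v : E3) (i : Fin 3) : v i ^ 2 ≤ v ⬝ᵥ v := by
  simp only [dotProduct, Fin.sum_univ_three]
  fin_cases i <;> simp <;>
    nlinarith [mul_self_nonneg (v 0), mul_self_nonneg (v 1), mul_self_nonneg (v 2)]

section Frame

variable {F₀ F₁ : E3}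

theorem cross_frame_zero_two (h₀ : F₀ ⬝ᵥ F₀ = 1) (h₀₁ : F₀ ⬝ᵥ F₁ = 0) :
    F₀ ⨯₃ (F₀ ⨯₃ F₁) = -F₁ := by
  rw [cross_cross_eq_smul_sub_smul', h₀, h₀₁]
  simp

theorem cross_frame_one_two (h₁ : F₁ ⬝ᵥ F₁ = 1) (h₀₁ : F₀ ⬝ᵥ F₁ = 0) :
    F₁ ⨯₃ (F₀ ⨯₃ F₁) = F₀ := by
  rw [cross_cross_eq_smul_sub_smul', h₁, h₀₁]
  simp

theorem frame_cross (h₀ : F₀ ⬝ᵥ F₀ = 1) (h₁ : F₁ ⬝ᵥ F₁ = 1) (h₀₁ : F₀ ⬝ᵥ F₁ = 0)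
    (x y z x' y' z' : ℝ) :
    frame F₀ F₁ x y z ⨯₃ frame F₀ F₁ x' y' z' =
      frame F₀ F₁ (y * z' - z * y') (z * x' - x * z') (x * y' - y * x') := by
  have h02 := cross_frame_zero_two h₀ h₀₁
  have h12 := cross_frame_one_two h₁ h₀₁
  have h20 : (F₀ ⨯₃ F₁) ⨯₃ F₀ = F₁ := by rw [← cross_anticomm, h02, neg_neg]
  have h21 : (F₀ ⨯₃ F₁) ⨯₃ F₁ = -F₀ := by rw [← cross_anticomm, h12]
  have h10 : F₁ ⨯₃ F₀ = -(F₀ ⨯₃ F₁) := (cross_anticomm _ _).symm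
  simp only [frame, map_add, map_smul, LinearMap.add_apply, LinearMap.smul_apply, cross_self,
    h02, h12, h20, h21, h10]
  module

theorem frame_dot (h₀ : F₀ ⬝ᵥ F₀ = 1) (h₁ : F₁ ⬝ᵥ F₁ = 1) (h₀₁ : F₀ ⬝ᵥ F₁ = 0)
    (x y z x' y' z' : ℝ) :
    frame F₀ F₁ x y z ⬝ᵥ frame F₀ F₁ x' y' z' = x * x' + y * y' + z * z' := by
  have h02 : F₀ ⬝ᵥ F₀ ⨯₃ F₁ = 0 := dot_self_cross _ _
  have h12 : F₁ ⬝ᵥ F₀ ⨯₃ F₁ = 0 := dot_cross_self _ _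
  have h20 : F₀ ⨯₃ F₁ ⬝ᵥ F₀ = 0 := by rw [dotProduct_comm, h02]
  have h21 : F₀ ⨯₃ F₁ ⬝ᵥ F₁ = 0 := by rw [dotProduct_comm, h12]
  have h10 : F₁ ⬝ᵥ F₀ = 0 := by rw [dotProduct_comm, h₀₁]
  have h22 : F₀ ⨯₃ F₁ ⬝ᵥ F₀ ⨯₃ F₁ = 1 := by
    rw [cross_dot_cross, h₀, h₁, h₀₁, h10]; ring
  simp only [frame, dotProduct_add, add_dotProduct, dotProduct_smul, smul_dotProduct,
    h₀, h₁, h₀₁, h02, h12, h20, h21, h10, h22, smul_eq_mul]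
  ring

theorem frame_add (x y z x' y' z' : ℝ) :
    frame F₀ F₁ x y z + frame F₀ F₁ x' y' z' = frame F₀ F₁ (x + x') (y + y') (z + z') := by
  simp only [frame]; module

theorem frame_sub (x y z x' y' z' : ℝ) :
    frame F₀ F₁ x y z - frame F₀ F₁ x' y' z' = frame F₀ F₁ (x - x') (y - y') (z - z') := by
  simp only [frame]; module

theorem frame_smul (a x y z : ℝ) :
    a • frame F₀ F₁ x y z = frame F₀ F₁ (a * x) (a * y) (a * z) := by
  simp only [frame]; module

theorem frame_zero_left : frame F₀ F₁ 1 0 0 = F₀ := by simp [frame]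

theorem rot_frame (h₀ : F₀ ⬝ᵥ F₀ = 1) (h₁ : F₁ ⬝ᵥ F₁ = 1) (h₀₁ : F₀ ⬝ᵥ F₁ = 0)
    (θ x y z : ℝ) :
    rot F₀ θ (frame F₀ F₁ x y z) =
      frame F₀ F₁ x (y * Real.cos θ + z * Real.sin θ) (z * Real.cos θ + -y * Real.sin θ) := by
  have h2 := frame_dot h₀ h₁ h₀₁ 1 0 0 x y z
  have h3 := frame_cross h₀ h₁ h₀₁ 1 0 0 x y z
  rw [frame_zero_left] at h2 h3
  rw [rot, h2, h3]
  simp only [frame]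
  module

theorem hasDerivAt_frame {x y z : ℝ → ℝ} {x' y' z' t : ℝ} (hx : HasDerivAt x x' t)
    (hy : HasDerivAt y y' t) (hz : HasDerivAt z z' t) :
    HasDerivAt (fun s => frame F₀ F₁ (x s) (y s) (z s)) (frame F₀ F₁ x' y' z') t :=
  ((hx.smul_const F₀).add (hy.smul_const F₁)).add (hz.smul_const (F₀ ⨯₃ F₁))

end Frame

theorem vBigO_frame {ι : Type*} {I : Set ℝ} {ε : ι → ℝ} {F₀ F₁ : ι → E3}
    (h₀ : ∀ p, F₀ p ⬝ᵥ F₀ p = 1) (h₁ : ∀ p, F₁ p ⬝ᵥ F₁ p = 1) {x y z : ι → ℝ → ℝ}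
    (hx : BigO I ε 0 x) (hy : BigO I ε 0 y) (hz : BigO I ε 0 z) :
    VBigO I ε 0 (fun p t => frame (F₀ p) (F₁ p) (x p t) (y p t) (z p t)) := by
  have key : ∀ F : ι → E3, (∀ p, F p ⬝ᵥ F p = 1) → VBigO I ε 0 (fun p _ => F p) := by
    intro F hF i
    refine BigO.const (K := 1) fun p => ?_
    have := sq_apply_le_dot_self (F p) i
    rw [hF] at this
    simpa using abs_le_one_iff_mul_self_le_one.2 (by nlinarith)
  exact ((VBigO.smul hx (key F₀ h₀)).add (VBigO.smul hy (key F₁ h₁))).add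
    (VBigO.smul hz (VBigO.cross (key F₀ h₀) (key F₁ h₁)))

/-- The oscillation `a cos (d (t - t₀)) + b sin (d (t - t₀))`. -/
noncomputable def osc (d t₀ a b t : ℝ) : ℝ :=
  a * Real.cos (d * (t - t₀)) + b * Real.sin (d * (t - t₀))

theorem hasDerivAt_osc (d t₀ a b t : ℝ) :
    HasDerivAt (osc d t₀ a b) (d * osc d t₀ b (-a) t) t := by
  have h : HasDerivAt (fun t => d * (t - t₀)) d t := by
    simpa using ((hasDerivAt_id t).sub_const t₀).const_mul d
  refine ((h.cos.const_mul a).add (h.sin.const_mul b)).congr_deriv ?_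
  rw [osc]; ring

theorem osc_neg (d t₀ a b t : ℝ) : osc d t₀ (-a) (-b) t = -osc d t₀ a b t := by
  rw [osc, osc]; ring

theorem hasDerivAt_osc_conj (d t₀ a b t : ℝ) :
    HasDerivAt (osc d t₀ b (-a)) (-(d * osc d t₀ a b t)) t := by
  refine (hasDerivAt_osc d t₀ b (-a) t).congr_deriv ?_
  rw [osc_neg]; ring

theorem osc_initial (d t₀ a b : ℝ) : osc d t₀ a b t₀ = a := by simp [osc]

theorem osc_sq_add_sq (d t₀ a b t : ℝ) :
    osc d t₀ a b t ^ 2 + osc d t₀ b (-a) t ^ 2 = a ^ 2 + b ^ 2 := by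
  rw [osc, osc]
  linear_combination (a ^ 2 + b ^ 2) * Real.sin_sq_add_cos_sq (d * (t - t₀))

theorem bigO_osc {ι : Type*} {I : Set ℝ} {ε : ι → ℝ} (d t₀ : ℝ) {a b : ι → ℝ} {K : ℝ}
    (ha : ∀ p, |a p| ≤ K) (hb : ∀ p, |b p| ≤ K) :
    BigO I ε 0 (fun p => osc d t₀ (a p) (b p)) := by
  intro n
  have key : ∀ a b : ι → ℝ, (∀ p, |a p| ≤ K) → (∀ p, |b p| ≤ K) →
      ∃ L, ∀ p, ∀ t ∈ I, |osc d t₀ (a p) (b p) t| ≤ L * ε p ^ 0 := by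
    intro a b ha hb
    refine ⟨K + K, fun p t _ => ?_⟩
    rw [pow_zero, mul_one, osc]
    refine (abs_add_le _ _).trans (add_le_add ?_ ?_) <;> rw [abs_mul]
    · exact (mul_le_of_le_one_right (abs_nonneg _) (Real.abs_cos_le_one _)).trans (ha p)
    · exact (mul_le_of_le_one_right (abs_nonneg _) (Real.abs_sin_le_one _)).trans (hb p)
  induction n generalizing a b with
  | zero => exact key a b ha hb
  | succ n ih =>
    refine ⟨key a b ha hb, _, fun p t _ => (hasDerivAt_osc d t₀ (a p) (b p) t).hasDerivWithinAt,
      ?_⟩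
    exact (BigO.real d n).mul (ih hb (by simpa using ha))

theorem bigO_sub_initial {ι : Type*} {ε : ι → ℝ} {t₀ t₁ : ℝ} (ht : t₀ ≤ t₁) :
    BigO (Set.Icc t₀ t₁) ε 0 (fun _ t => t - t₀) :=
  BigO.of_deriv (f' := fun _ _ => 1) ht ⟨0, by simp⟩
    (fun _ t _ => ((hasDerivAt_id t).sub_const t₀).hasDerivWithinAt) (BigO.real 1)

/-! ### Lie quadratics with initial data close to those of a constant -/

/-- A Lie quadratic `V` on `[t₀,t₁]` whose 2-jet at `t₀` is the value at `h` of the affine family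
of initial jets under consideration. The parameters `d, a₁₁, a₁₂, β, c₂` and the bound `M` are
fixed; everything else varies with the datum. The frame is `F₀, F₁, F₀ × F₁`. -/
structure Datum (t₀ t₁ d a₁₁ a₁₂ β c₂ M : ℝ) where
  h : ℝ
  c₀ : ℝ
  c₁ : ℝ
  a₀₁ : ℝ
  a₀₂ : ℝ
  γ : ℝ
  F₀ : E3
  F₁ : E3
  V : ℝ → E3
  abs_h : |h| ≤ 1
  abs_c₀ : |c₀| ≤ M
  abs_c₁ : |c₁| ≤ M
  abs_a₀₁ : |a₀₁| ≤ M
  abs_a₀₂ : |a₀₂| ≤ M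
  dot₀ : F₀ ⬝ᵥ F₀ = 1
  dot₁ : F₁ ⬝ᵥ F₁ = 1
  dot₀₁ : F₀ ⬝ᵥ F₁ = 0
  quadratic : IsLieQuadratic t₀ t₁ V
  init₀ : V t₀ = d • F₀ + h • frame F₀ F₁ c₀ (a₀₁ + β * Real.cos γ) (a₀₂ + β * Real.sin γ)
  init₁ : derivWithin V (Set.Icc t₀ t₁) t₀ =
    h • frame F₀ F₁ c₁ (a₁₁ + d * (β * Real.sin γ)) (a₁₂ - d * (β * Real.cos γ))
  init₂ : iteratedDerivWithin 2 V (Set.Icc t₀ t₁) t₀ =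
    h • frame F₀ F₁ (2 * c₂) (-(d ^ 2 * (β * Real.cos γ))) (-(d ^ 2 * (β * Real.sin γ)))

namespace Datum

variable {t₀ t₁ d a₁₁ a₁₂ β c₂ M : ℝ} (p : Datum t₀ t₁ d a₁₁ a₁₂ β c₂ M)

/-- The vector with coordinates `x, y, z` in the frame of the datum. -/
def fr (x y z : ℝ) : E3 := frame p.F₀ p.F₁ x y z

/-- The first coordinate of `exp (-d (t - t₀) ad F₀) B` in the plane orthogonal to `F₀`. -/
noncomputable def y₁ (t : ℝ) : ℝ := osc d t₀ (β * Real.cos p.γ) (β * Real.sin p.γ) t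

/-- The second coordinate of `exp (-d (t - t₀) ad F₀) B` in the plane orthogonal to `F₀`. -/
noncomputable def y₂ (t : ℝ) : ℝ := osc d t₀ (β * Real.sin p.γ) (-(β * Real.cos p.γ)) t

/-- The first variation of the constant Lie quadratic `d F₀`. -/
noncomputable def U (t : ℝ) : E3 :=
  p.fr (p.c₀ + p.c₁ * (t - t₀) + c₂ * (t - t₀) ^ 2) (p.a₀₁ + (t - t₀) * a₁₁ + p.y₁ t)
    (p.a₀₂ + (t - t₀) * a₁₂ + p.y₂ t)

/-- The derivative of the first variation. -/
noncomputable def U' (t : ℝ) : E3 :=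
  p.fr (p.c₁ + 2 * c₂ * (t - t₀)) (a₁₁ + d * p.y₂ t) (a₁₂ - d * p.y₁ t)

/-- The second derivative of the first variation. -/
noncomputable def W (t : ℝ) : E3 := p.fr (2 * c₂) (-(d ^ 2 * p.y₁ t)) (-(d ^ 2 * p.y₂ t))

/-- The third derivative of the first variation. -/
noncomputable def W' (t : ℝ) : E3 := p.fr 0 (-(d ^ 3 * p.y₂ t)) (d ^ 3 * p.y₁ t)

/-- The second derivative of the second variation, in closed form. -/
noncomputable def Y (t : ℝ) : E3 :=
  p.fr
    (2 * d * (p.a₀₁ * (p.y₁ t - β * Real.cos p.γ) + p.a₀₂ * (p.y₂ t - β * Real.sin p.γ))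
      + 2 * (a₁₁ * (p.y₂ t - β * Real.sin p.γ + d * (t - t₀) * p.y₁ t)
        - a₁₂ * (p.y₁ t - β * Real.cos p.γ - d * (t - t₀) * p.y₂ t)))
    (-(4 * c₂ / d) * (osc d t₀ p.a₀₁ p.a₀₂ t - p.a₀₁)
      + 4 * c₂ / d ^ 2 * (d * (t - t₀) * a₁₁ + (osc d t₀ a₁₂ (-a₁₁) t - a₁₂))
      - 2 * (2 * c₂ * (t - t₀) + d ^ 2 *
        (c₂ * (t - t₀) ^ 3 / 3 + p.c₁ * (t - t₀) ^ 2 / 2 + p.c₀ * (t - t₀))) * p.y₂ t)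
    (-(4 * c₂ / d) * (osc d t₀ p.a₀₂ (-p.a₀₁) t - p.a₀₂)
      + 4 * c₂ / d ^ 2 * (d * (t - t₀) * a₁₂ - (osc d t₀ a₁₁ a₁₂ t - a₁₁))
      + 2 * (2 * c₂ * (t - t₀) + d ^ 2 *
        (c₂ * (t - t₀) ^ 3 / 3 + p.c₁ * (t - t₀) ^ 2 / 2 + p.c₀ * (t - t₀))) * p.y₁ t)

theorem fr_cross (x y z x' y' z' : ℝ) :
    p.fr x y z ⨯₃ p.fr x' y' z' =
      p.fr (y * z' - z * y') (z * x' - x * z') (x * y' - y * x') :=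
  frame_cross p.dot₀ p.dot₁ p.dot₀₁ x y z x' y' z'

theorem fr_dot (x y z x' y' z' : ℝ) :
    p.fr x y z ⬝ᵥ p.fr x' y' z' = x * x' + y * y' + z * z' :=
  frame_dot p.dot₀ p.dot₁ p.dot₀₁ x y z x' y' z'

theorem fr_smul (a x y z : ℝ) : a • p.fr x y z = p.fr (a * x) (a * y) (a * z) := frame_smul ..

theorem fr_add (x y z x' y' z' : ℝ) :
    p.fr x y z + p.fr x' y' z' = p.fr (x + x') (y + y') (z + z') := frame_add ..

theorem F₀_eq : p.F₀ = p.fr 1 0 0 := frame_zero_left.symm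

theorem hasDerivAt_y₁ (t : ℝ) : HasDerivAt p.y₁ (d * p.y₂ t) t := hasDerivAt_osc ..

theorem hasDerivAt_y₂ (t : ℝ) : HasDerivAt p.y₂ (-(d * p.y₁ t)) t := hasDerivAt_osc_conj ..

theorem y_sq (t : ℝ) : p.y₁ t ^ 2 + p.y₂ t ^ 2 = β ^ 2 := by
  rw [y₁, y₂, osc_sq_add_sq]
  linear_combination β ^ 2 * Real.cos_sq_add_sin_sq p.γ

theorem y₁_initial : p.y₁ t₀ = β * Real.cos p.γ := osc_initial ..

theorem y₂_initial : p.y₂ t₀ = β * Real.sin p.γ := osc_initial ..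

theorem hasDerivAt_sub_initial (t : ℝ) : HasDerivAt (fun t => t - t₀) 1 t :=
  (hasDerivAt_id t).sub_const t₀

theorem hasDerivAt_U (t : ℝ) : HasDerivAt p.U (p.U' t) t := by
  have hs := hasDerivAt_sub_initial (t₀ := t₀) t
  refine hasDerivAt_frame ?_ ?_ ?_
  · exact (((hs.const_mul p.c₁).const_add p.c₀).add ((hs.pow 2).const_mul c₂)).congr_deriv
      (by push_cast; ring)
  · exact (((hs.mul_const a₁₁).const_add p.a₀₁).add (p.hasDerivAt_y₁ t)).congr_deriv (by ring)
  · exact (((hs.mul_const a₁₂).const_add p.a₀₂).add (p.hasDerivAt_y₂ t)).congr_deriv (by ring)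

theorem hasDerivAt_U' (t : ℝ) : HasDerivAt p.U' (p.W t) t := by
  have hs := hasDerivAt_sub_initial (t₀ := t₀) t
  refine hasDerivAt_frame ?_ ?_ ?_
  · exact ((hs.const_mul (2 * c₂)).const_add p.c₁).congr_deriv (by ring)
  · exact (((p.hasDerivAt_y₂ t).const_mul d).const_add a₁₁).congr_deriv (by ring)
  · exact (((p.hasDerivAt_y₁ t).const_mul d).const_sub a₁₂).congr_deriv (by ring)

theorem hasDerivAt_W (t : ℝ) : HasDerivAt p.W (p.W' t) t := by
  refine hasDerivAt_frame (hasDerivAt_const _ _) ?_ ?_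
  · exact ((p.hasDerivAt_y₁ t).const_mul (d ^ 2)).neg.congr_deriv (by ring)
  · exact ((p.hasDerivAt_y₂ t).const_mul (d ^ 2)).neg.congr_deriv (by ring)

theorem W'_eq (t : ℝ) : p.W' t = p.W t ⨯₃ (d • p.F₀) := by
  rw [W, W', F₀_eq, fr_smul, fr_cross]
  congr 1 <;> ring

/-- The linearized equation for the second derivative of the second variation. -/
theorem hasDerivAt_Y (hd : d ≠ 0) (t : ℝ) :
    HasDerivAt p.Y (p.Y t ⨯₃ (d • p.F₀) + (2 : ℝ) • (p.W t ⨯₃ p.U t)) t := by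
  have hs := hasDerivAt_sub_initial (t₀ := t₀) t
  have h1 := p.hasDerivAt_y₁ t
  have h2 := p.hasDerivAt_y₂ t
  have hds := hs.const_mul d
  have hq := ((hs.const_mul (2 * c₂)).add (((((hs.pow 3).const_mul c₂).div_const 3).add
    (((hs.pow 2).const_mul p.c₁).div_const 2)).add (hs.const_mul p.c₀) |>.const_mul
      (d ^ 2))).const_mul 2
  have key : p.Y t ⨯₃ (d • p.F₀) + (2 : ℝ) • (p.W t ⨯₃ p.U t) = p.fr
      (2 * d ^ 2 * (p.y₂ t * p.a₀₁ - p.y₁ t * p.a₀₂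
        + (t - t₀) * (p.y₂ t * a₁₁ - p.y₁ t * a₁₂)))
      (d * (-(4 * c₂ / d) * (osc d t₀ p.a₀₂ (-p.a₀₁) t - p.a₀₂)
        + 4 * c₂ / d ^ 2 * (d * (t - t₀) * a₁₂ - (osc d t₀ a₁₁ a₁₂ t - a₁₁))
        + 2 * (2 * c₂ * (t - t₀) + d ^ 2 *
        (c₂ * (t - t₀) ^ 3 / 3 + p.c₁ * (t - t₀) ^ 2 / 2 + p.c₀ * (t - t₀))) * p.y₁ t)
        + 2 * (-(d ^ 2 * p.y₂ t) * (p.c₀ + p.c₁ * (t - t₀) + c₂ * (t - t₀) ^ 2)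
          - 2 * c₂ * (p.a₀₂ + (t - t₀) * a₁₂ + p.y₂ t)))
      (-d * (-(4 * c₂ / d) * (osc d t₀ p.a₀₁ p.a₀₂ t - p.a₀₁)
        + 4 * c₂ / d ^ 2 * (d * (t - t₀) * a₁₁ + (osc d t₀ a₁₂ (-a₁₁) t - a₁₂))
        - 2 * (2 * c₂ * (t - t₀) + d ^ 2 *
        (c₂ * (t - t₀) ^ 3 / 3 + p.c₁ * (t - t₀) ^ 2 / 2 + p.c₀ * (t - t₀))) * p.y₂ t)
        + 2 * (2 * c₂ * (p.a₀₁ + (t - t₀) * a₁₁ + p.y₁ t)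
          + d ^ 2 * p.y₁ t * (p.c₀ + p.c₁ * (t - t₀) + c₂ * (t - t₀) ^ 2))) := by
    rw [Y, W, U, F₀_eq, fr_smul, fr_cross, fr_cross, fr_smul, fr_add]
    congr 1 <;> ring
  rw [key]
  refine hasDerivAt_frame ?_ ?_ ?_
  · refine (((((h1.sub_const (β * Real.cos p.γ)).const_mul p.a₀₁).add
      ((h2.sub_const (β * Real.sin p.γ)).const_mul p.a₀₂)).const_mul (2 * d)).add
      (((((h2.sub_const (β * Real.sin p.γ)).add (hds.mul h1)).const_mul a₁₁).sub
        (((h1.sub_const (β * Real.cos p.γ)).sub (hds.mul h2)).const_mul a₁₂)).const_mul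
          2)).congr_deriv ?_
    ring
  · refine (((((hasDerivAt_osc d t₀ p.a₀₁ p.a₀₂ t).sub_const p.a₀₁).const_mul
      (-(4 * c₂ / d))).add (((hds.mul_const a₁₁).add
        ((hasDerivAt_osc_conj d t₀ a₁₁ a₁₂ t).sub_const a₁₂)).const_mul (4 * c₂ / d ^ 2))).sub
        (hq.mul h2)).congr_deriv ?_
    simp only [Pi.pow_apply, Pi.add_apply]
    push_cast
    field_simp
    ring
  · refine (((((hasDerivAt_osc_conj d t₀ p.a₀₁ p.a₀₂ t).sub_const p.a₀₂).const_mul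
      (-(4 * c₂ / d))).add (((hds.mul_const a₁₂).sub
        ((hasDerivAt_osc d t₀ a₁₁ a₁₂ t).sub_const a₁₁)).const_mul (4 * c₂ / d ^ 2))).add
        (hq.mul h1)).congr_deriv ?_
    simp only [Pi.pow_apply, Pi.add_apply]
    push_cast
    field_simp
    ring

theorem Y_initial : p.Y t₀ = 0 := by
  simp [Y, y₁_initial, y₂_initial, osc_initial, fr, frame]

end Datum

/-! ### Asymptotics of Lie quadratics -/

theorem hasDerivWithinAt_cross {u v : ℝ → E3} {u' v' : E3} {I : Set ℝ} {t : ℝ}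
    (hu : HasDerivWithinAt u u' I t) (hv : HasDerivWithinAt v v' I t) :
    HasDerivWithinAt (fun s => u s ⨯₃ v s) (u' ⨯₃ v t + u t ⨯₃ v') I t := by
  rw [hasDerivWithinAt_pi] at hu hv ⊢
  intro i
  fin_cases i <;> simp only [cross_apply]
  · refine (((hu 1).fun_mul (hv 2)).fun_sub ((hu 2).fun_mul (hv 1))).congr_deriv ?_
    simp; ring
  · refine (((hu 2).fun_mul (hv 0)).fun_sub ((hu 0).fun_mul (hv 2))).congr_deriv ?_
    simp; ring
  · refine (((hu 0).fun_mul (hv 1)).fun_sub ((hu 1).fun_mul (hv 0))).congr_deriv ?_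
    simp; ring

theorem hasDerivWithinAt_dot {u v : ℝ → E3} {u' v' : E3} {I : Set ℝ} {t : ℝ}
    (hu : HasDerivWithinAt u u' I t) (hv : HasDerivWithinAt v v' I t) :
    HasDerivWithinAt (fun s => u s ⬝ᵥ v s) (u' ⬝ᵥ v t + u t ⬝ᵥ v') I t := by
  rw [hasDerivWithinAt_pi] at hu hv
  simp only [dotProduct, Fin.sum_univ_three]
  refine ((((hu 0).fun_mul (hv 0)).fun_add ((hu 1).fun_mul (hv 1))).fun_add
    ((hu 2).fun_mul (hv 2))).congr_deriv ?_
  ring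

/-- The first three derivatives of a Lie quadratic; in particular `V''' = V'' × V`. -/
theorem IsLieQuadratic.hasDerivWithinAt {t₀ t₁ : ℝ} (ht : t₀ < t₁) {V : ℝ → E3}
    (hV : IsLieQuadratic t₀ t₁ V) {t : ℝ} (htI : t ∈ Set.Icc t₀ t₁) :
    HasDerivWithinAt V (derivWithin V (Set.Icc t₀ t₁) t) (Set.Icc t₀ t₁) t ∧
    HasDerivWithinAt (derivWithin V (Set.Icc t₀ t₁))
      (iteratedDerivWithin 2 V (Set.Icc t₀ t₁) t) (Set.Icc t₀ t₁) t ∧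
    HasDerivWithinAt (iteratedDerivWithin 2 V (Set.Icc t₀ t₁))
      (iteratedDerivWithin 2 V (Set.Icc t₀ t₁) t ⨯₃ V t) (Set.Icc t₀ t₁) t := by
  obtain ⟨hs, C, hC⟩ := hV
  have hI := uniqueDiffOn_Icc ht
  obtain ⟨d1, s1⟩ := (contDiffOn_infty_iff_derivWithin hI).1 hs
  obtain ⟨d2, -⟩ := (contDiffOn_infty_iff_derivWithin hI).1 s1
  have h1 := (d1 t htI).hasDerivWithinAt
  have h2 : HasDerivWithinAt (derivWithin V (Set.Icc t₀ t₁))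
      (iteratedDerivWithin 2 V (Set.Icc t₀ t₁) t) (Set.Icc t₀ t₁) t := by
    have := (d2 t htI).hasDerivWithinAt
    rwa [show derivWithin (derivWithin V (Set.Icc t₀ t₁)) (Set.Icc t₀ t₁) t =
      iteratedDerivWithin 2 V (Set.Icc t₀ t₁) t by
        rw [iteratedDerivWithin_succ', iteratedDerivWithin_one]] at this
  refine ⟨h1, h2, ?_⟩
  refine (((hasDerivWithinAt_cross h2 h1).add_const C).congr_deriv ?_).congr hC (hC t htI)
  simp

/-- The second derivative of a Lie quadratic has constant length. -/
theorem IsLieQuadratic.dot_self_accel {t₀ t₁ : ℝ} (ht : t₀ < t₁) {V : ℝ → E3}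
    (hV : IsLieQuadratic t₀ t₁ V) {t : ℝ} (htI : t ∈ Set.Icc t₀ t₁) :
    iteratedDerivWithin 2 V (Set.Icc t₀ t₁) t ⬝ᵥ iteratedDerivWithin 2 V (Set.Icc t₀ t₁) t =
      iteratedDerivWithin 2 V (Set.Icc t₀ t₁) t₀ ⬝ᵥ
        iteratedDerivWithin 2 V (Set.Icc t₀ t₁) t₀ := by
  have key : ∀ s ∈ Set.Icc t₀ t₁, HasDerivWithinAt (fun s =>
      iteratedDerivWithin 2 V (Set.Icc t₀ t₁) s ⬝ᵥ iteratedDerivWithin 2 V (Set.Icc t₀ t₁) s)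
      0 (Set.Icc t₀ t₁) s := by
    intro s hs
    have h := (hV.hasDerivWithinAt ht hs).2.2
    refine (hasDerivWithinAt_dot h h).congr_deriv ?_
    rw [dotProduct_comm (_ ⨯₃ _), dot_self_cross, add_zero]
  have := Convex.norm_image_sub_le_of_norm_hasDerivWithin_le (C := 0) key (by simp)
    (convex_Icc t₀ t₁) (Set.left_mem_Icc.2 ht.le) htI
  simpa [sub_eq_zero] using this

namespace Datum

section Bounds

variable {t₀ t₁ d a₁₁ a₁₂ β c₂ M : ℝ}

local notation "𝓓" => Datum t₀ t₁ d a₁₁ a₁₂ β c₂ M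

/-- The velocity of the Lie quadratic of a datum. -/
noncomputable def V' (p : 𝓓) : ℝ → E3 := derivWithin p.V (Set.Icc t₀ t₁)

/-- The acceleration of the Lie quadratic of a datum. -/
noncomputable def V'' (p : 𝓓) : ℝ → E3 := iteratedDerivWithin 2 p.V (Set.Icc t₀ t₁)

/-- The size of the perturbation. -/
def ε (p : 𝓓) : ℝ := |p.h|

theorem ε_mem (p : 𝓓) : 0 ≤ p.ε ∧ p.ε ≤ 1 := ⟨abs_nonneg _, p.abs_h⟩

theorem bigO_y₁ : BigO (Set.Icc t₀ t₁) ε 0 (y₁ : 𝓓 → ℝ → ℝ) :=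
  bigO_osc d t₀ (K := |β|)
    (fun p => by
      rw [abs_mul]; exact mul_le_of_le_one_right (abs_nonneg _) (Real.abs_cos_le_one _))
    (fun p => by
      rw [abs_mul]; exact mul_le_of_le_one_right (abs_nonneg _) (Real.abs_sin_le_one _))

theorem bigO_y₂ : BigO (Set.Icc t₀ t₁) ε 0 (y₂ : 𝓓 → ℝ → ℝ) :=
  bigO_osc d t₀ (K := |β|)
    (fun p => by
      rw [abs_mul]; exact mul_le_of_le_one_right (abs_nonneg _) (Real.abs_sin_le_one _))
    (fun p => by
      rw [abs_neg, abs_mul]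
      exact mul_le_of_le_one_right (abs_nonneg _) (Real.abs_cos_le_one _))

theorem vBigO_fr {x y z : 𝓓 → ℝ → ℝ} (hx : BigO (Set.Icc t₀ t₁) ε 0 x)
    (hy : BigO (Set.Icc t₀ t₁) ε 0 y) (hz : BigO (Set.Icc t₀ t₁) ε 0 z) :
    VBigO (Set.Icc t₀ t₁) ε 0 (fun (p : 𝓓) t => p.fr (x p t) (y p t) (z p t)) :=
  vBigO_frame (fun p : 𝓓 => p.dot₀) (fun p => p.dot₁) hx hy hz

theorem bigO_c₀ : BigO (Set.Icc t₀ t₁) ε 0 (fun (p : 𝓓) _ => p.c₀) :=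
  BigO.const (K := M) fun p => by simpa using p.abs_c₀

theorem bigO_c₁ : BigO (Set.Icc t₀ t₁) ε 0 (fun (p : 𝓓) _ => p.c₁) :=
  BigO.const (K := M) fun p => by simpa using p.abs_c₁

theorem bigO_a₀₁ : BigO (Set.Icc t₀ t₁) ε 0 (fun (p : 𝓓) _ => p.a₀₁) :=
  BigO.const (K := M) fun p => by simpa using p.abs_a₀₁

theorem bigO_a₀₂ : BigO (Set.Icc t₀ t₁) ε 0 (fun (p : 𝓓) _ => p.a₀₂) :=
  BigO.const (K := M) fun p => by simpa using p.abs_a₀₂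

theorem vBigO_U' (ht : t₀ ≤ t₁) : VBigO (Set.Icc t₀ t₁) ε 0 (U' : 𝓓 → ℝ → E3) :=
  vBigO_fr (bigO_c₁.add ((BigO.real (2 * c₂)).mul (bigO_sub_initial ht)))
    ((BigO.real a₁₁).add ((BigO.real d).mul bigO_y₂))
    ((BigO.real a₁₂).sub ((BigO.real d).mul bigO_y₁))

theorem vBigO_U (ht : t₀ ≤ t₁) : VBigO (Set.Icc t₀ t₁) ε 0 (U : 𝓓 → ℝ → E3) := by
  have hs : BigO (Set.Icc t₀ t₁) ε 0 (fun (_ : 𝓓) t => t - t₀) := bigO_sub_initial ht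
  refine vBigO_fr ?_ ((bigO_a₀₁.add (hs.mul (BigO.real a₁₁))).add bigO_y₁)
    ((bigO_a₀₂.add (hs.mul (BigO.real a₁₂))).add bigO_y₂)
  simp only [pow_two]
  exact (bigO_c₀.add (bigO_c₁.mul hs)).add ((BigO.real c₂).mul (hs.mul hs))

theorem vBigO_W : VBigO (Set.Icc t₀ t₁) ε 0 (W : 𝓓 → ℝ → E3) :=
  vBigO_fr (BigO.real _) ((BigO.real (d ^ 2)).mul bigO_y₁).neg
    ((BigO.real (d ^ 2)).mul bigO_y₂).neg

theorem vBigO_W' : VBigO (Set.Icc t₀ t₁) ε 0 (W' : 𝓓 → ℝ → E3) :=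
  vBigO_fr (BigO.real _) ((BigO.real (d ^ 3)).mul bigO_y₂).neg
    ((BigO.real (d ^ 3)).mul bigO_y₁)

theorem vBigO_Y (ht : t₀ ≤ t₁) : VBigO (Set.Icc t₀ t₁) ε 0 (Y : 𝓓 → ℝ → E3) := by
  have hs : BigO (Set.Icc t₀ t₁) ε 0 (fun (_ : 𝓓) t => t - t₀) := bigO_sub_initial ht
  have hγ₁ : BigO (Set.Icc t₀ t₁) ε 0 (fun (p : 𝓓) _ => β * Real.cos p.γ) :=
    (BigO.real β).mul (l := 0) (BigO.const (c := fun p : 𝓓 => Real.cos p.γ) (K := 1) fun p => by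
      simpa using Real.abs_cos_le_one _)
  have hγ₂ : BigO (Set.Icc t₀ t₁) ε 0 (fun (p : 𝓓) _ => β * Real.sin p.γ) :=
    (BigO.real β).mul (l := 0) (BigO.const (c := fun p : 𝓓 => Real.sin p.γ) (K := 1) fun p => by
      simpa using Real.abs_sin_le_one _)
  have hq : BigO (Set.Icc t₀ t₁) ε 0 (fun (p : 𝓓) t => 2 * (2 * c₂ * (t - t₀) + d ^ 2 *
        (c₂ * (t - t₀) ^ 3 / 3 + p.c₁ * (t - t₀) ^ 2 / 2 + p.c₀ * (t - t₀)))) := by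
    simp only [pow_succ, pow_zero, one_mul, div_eq_mul_inv]
    exact (BigO.real 2).mul (((BigO.real (2 * c₂)).mul hs).add ((BigO.real (d * d)).mul
      (((((BigO.real c₂).mul ((hs.mul hs).mul hs)).mul (BigO.real 3⁻¹)).add
        ((bigO_c₁.mul (hs.mul hs)).mul (BigO.real 2⁻¹))).add (bigO_c₀.mul hs))))
  have hds : BigO (Set.Icc t₀ t₁) ε 0 (fun (_ : 𝓓) t => d * (t - t₀)) := (BigO.real d).mul hs
  have ho₁ : BigO (Set.Icc t₀ t₁) ε 0 (fun (p : 𝓓) => osc d t₀ p.a₀₁ p.a₀₂) :=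
    bigO_osc d t₀ (fun p => p.abs_a₀₁) (fun p => p.abs_a₀₂)
  have ho₂ : BigO (Set.Icc t₀ t₁) ε 0 (fun (p : 𝓓) => osc d t₀ p.a₀₂ (-p.a₀₁)) :=
    bigO_osc d t₀ (fun p => p.abs_a₀₂) (fun p => by rw [abs_neg]; exact p.abs_a₀₁)
  have ho₃ : BigO (Set.Icc t₀ t₁) ε 0 (fun (_ : 𝓓) => osc d t₀ a₁₁ a₁₂) :=
    bigO_osc d t₀ (fun _ => le_max_left _ _) (fun _ => le_max_right _ _)
  have ho₄ : BigO (Set.Icc t₀ t₁) ε 0 (fun (_ : 𝓓) => osc d t₀ a₁₂ (-a₁₁)) :=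
    bigO_osc d t₀ (fun _ => le_max_left _ _) (fun _ => le_max_right _ _)
  refine vBigO_fr ?_ ?_ ?_
  · exact ((BigO.real (2 * d)).mul ((bigO_a₀₁.mul (bigO_y₁.sub hγ₁)).add
      (bigO_a₀₂.mul (bigO_y₂.sub hγ₂)))).add ((BigO.real 2).mul
        (((BigO.real a₁₁).mul ((bigO_y₂.sub hγ₂).add (hds.mul bigO_y₁))).sub
          ((BigO.real a₁₂).mul ((bigO_y₁.sub hγ₁).sub (hds.mul bigO_y₂)))))
  · exact (((BigO.real (-(4 * c₂ / d))).mul (ho₁.sub bigO_a₀₁)).add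
      ((BigO.real (4 * c₂ / d ^ 2)).mul ((hds.mul (BigO.real a₁₁)).add
        (ho₄.sub (BigO.real a₁₂))))).sub (hq.mul bigO_y₂)
  · exact (((BigO.real (-(4 * c₂ / d))).mul (ho₂.sub bigO_a₀₂)).add
      ((BigO.real (4 * c₂ / d ^ 2)).mul ((hds.mul (BigO.real a₁₂)).sub
        (ho₃.sub (BigO.real a₁₁))))).add (hq.mul bigO_y₁)

/-! ### Expansion of the Lie quadratic in the perturbation -/

theorem bigO_h : BigO (Set.Icc t₀ t₁) ε 1 (fun (p : 𝓓) _ => p.h) :=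
  BigO.const (K := 1) fun p => by simp [ε]

theorem init_V (p : 𝓓) : p.V t₀ = d • p.F₀ + p.h • p.U t₀ := by
  rw [p.init₀, U, y₁_initial, y₂_initial, fr]; simp

theorem init_V' (p : 𝓓) : p.V' t₀ = p.h • p.U' t₀ := by
  rw [V', p.init₁, U', y₁_initial, y₂_initial, fr]; simp

theorem init_V'' (p : 𝓓) : p.V'' t₀ = p.h • p.W t₀ := by
  rw [V'', p.init₂, W, y₁_initial, y₂_initial, fr]

theorem W_dot_W (p : 𝓓) (t : ℝ) : p.W t ⬝ᵥ p.W t = 4 * c₂ ^ 2 + d ^ 4 * β ^ 2 := by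
  rw [W, fr_dot, ← p.y_sq t]; ring

theorem hasDerivWithinAt_V (ht : t₀ < t₁) (p : 𝓓) {t : ℝ} (htI : t ∈ Set.Icc t₀ t₁) :
    HasDerivWithinAt p.V (p.V' t) (Set.Icc t₀ t₁) t := (p.quadratic.hasDerivWithinAt ht htI).1

theorem hasDerivWithinAt_V' (ht : t₀ < t₁) (p : 𝓓) {t : ℝ} (htI : t ∈ Set.Icc t₀ t₁) :
    HasDerivWithinAt p.V' (p.V'' t) (Set.Icc t₀ t₁) t :=
  (p.quadratic.hasDerivWithinAt ht htI).2.1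

theorem hasDerivWithinAt_V'' (ht : t₀ < t₁) (p : 𝓓) {t : ℝ} (htI : t ∈ Set.Icc t₀ t₁) :
    HasDerivWithinAt p.V'' (p.V'' t ⨯₃ p.V t) (Set.Icc t₀ t₁) t :=
  (p.quadratic.hasDerivWithinAt ht htI).2.2

theorem abs_F₀_apply_le (p : 𝓓) (i : Fin 3) : |p.F₀ i| ≤ 1 := by
  have := sq_apply_le_dot_self p.F₀ i
  rw [p.dot₀] at this
  exact abs_le_one_iff_mul_self_le_one.2 (by nlinarith)

theorem vBigO_D : VBigO (Set.Icc t₀ t₁) ε 0 (fun (p : 𝓓) _ => d • p.F₀) := fun i =>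
  (BigO.real d).mul (l := 0) (BigO.const (c := fun p : 𝓓 => p.F₀ i) (K := 1) fun p => by
    simpa using p.abs_F₀_apply_le i)

/-- Initial values proportional to `h` are of first order. -/
theorem exists_initial_bound {u : 𝓓 → ℝ → E3} (ht : t₀ ≤ t₁)
    (hu : VBigO (Set.Icc t₀ t₁) ε 0 u) :
    ∃ K, ∀ (p : 𝓓) (i : Fin 3), |(p.h • u p t₀) i| ≤ K * p.ε ^ 1 := by
  obtain ⟨K, hK⟩ := hu.norm_bound fun p => p.ε_mem.1
  refine ⟨K, fun p i => ?_⟩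
  have h1 := (norm_le_pi_norm (u p t₀) i).trans (hK p t₀ (Set.left_mem_Icc.2 ht))
  rw [pow_zero, mul_one, Real.norm_eq_abs] at h1
  rw [Pi.smul_apply, smul_eq_mul, abs_mul, pow_one, mul_comm]
  exact mul_le_mul_of_nonneg_right h1 (abs_nonneg _)

/-- Integrating the acceleration: `V'` and `V - d F₀` are as regular as `V''`, and of first order
because their initial values are. -/
theorem upTo_integrate (ht : t₀ < t₁) {n : ℕ}
    (h : ∀ i, BigOUpTo (Set.Icc t₀ t₁) ε 1 n (fun (p : 𝓓) t => p.V'' t i)) :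
    (∀ i, BigOUpTo (Set.Icc t₀ t₁) ε 1 n (fun (p : 𝓓) t => p.V' t i)) ∧
    ∀ i, BigOUpTo (Set.Icc t₀ t₁) ε 1 n (fun (p : 𝓓) t => (p.V t - d • p.F₀) i) := by
  obtain ⟨K, hK⟩ := exists_initial_bound (t₀ := t₀) ht.le
    (vBigO_U' (d := d) (a₁₁ := a₁₁) (a₁₂ := a₁₂) (β := β) (c₂ := c₂) (M := M) ht.le)
  obtain ⟨L, hL⟩ := exists_initial_bound (t₀ := t₀) ht.le
    (vBigO_U (d := d) (a₁₁ := a₁₁) (a₁₂ := a₁₂) (β := β) (c₂ := c₂) (M := M) ht.le)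
  have h1 : ∀ i, BigOUpTo (Set.Icc t₀ t₁) ε 1 n (fun (p : 𝓓) t => p.V' t i) := fun i =>
    (h i).of_deriv ht.le ⟨K, fun p => by rw [p.init_V']; exact hK p i⟩
      fun p t htI => hasDerivWithinAt_pi.1 (p.hasDerivWithinAt_V' ht htI) i
  refine ⟨h1, fun i => (h1 i).of_deriv ht.le ⟨L, fun p => ?_⟩ fun p t htI =>
    hasDerivWithinAt_pi.1 ((p.hasDerivWithinAt_V ht htI).sub_const _) i⟩
  rw [p.init_V, add_sub_cancel_left]; exact hL p i

/-- The acceleration is of first order: its length is constant, which bounds it; the equation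
`V''' = V'' × V` then bounds its derivatives. -/
theorem vBigO_V'' (ht : t₀ < t₁) : VBigO (Set.Icc t₀ t₁) ε 1 (V'' : 𝓓 → ℝ → E3) := by
  refine BigO.of_bootstrap (f := fun i (p : 𝓓) t => p.V'' t i)
    (f' := fun i p t => (p.V'' t ⨯₃ p.V t) i) (fun i => ?_)
    (fun i p t htI => hasDerivWithinAt_pi.1 (p.hasDerivWithinAt_V'' ht htI) i) fun n hn i => ?_
  · refine ⟨Real.sqrt (4 * c₂ ^ 2 + d ^ 4 * β ^ 2), fun p t htI => ?_⟩
    have h1 := sq_apply_le_dot_self (p.V'' t) i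
    have h2 : p.V'' t ⬝ᵥ p.V'' t = p.h ^ 2 * (4 * c₂ ^ 2 + d ^ 4 * β ^ 2) := by
      refine (p.quadratic.dot_self_accel ht htI).trans ?_
      change p.V'' t₀ ⬝ᵥ p.V'' t₀ = _
      rw [p.init_V'', smul_dotProduct, dotProduct_smul, W_dot_W]
      simp only [smul_eq_mul]; ring
    rw [h2] at h1
    refine (Real.abs_le_sqrt h1).trans_eq ?_
    rw [Real.sqrt_mul (sq_nonneg _), Real.sqrt_sq_eq_abs, pow_one, mul_comm, ε]
  · have h1 := (upTo_integrate ht hn).2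
    have h2 : ∀ i, BigOUpTo (Set.Icc t₀ t₁) ε 0 n (fun (p : 𝓓) t => p.V t i) := fun i =>
      (((h1 i).weaken (fun p => p.ε_mem) zero_le_one).add (vBigO_D i n)).congr
        fun p t _ => by simp
    exact BigOUpTo.cross (l := 0) hn h2 i

theorem vBigO_V' (ht : t₀ < t₁) : VBigO (Set.Icc t₀ t₁) ε 1 (V' : 𝓓 → ℝ → E3) :=
  fun i n => (upTo_integrate ht fun i => vBigO_V'' ht i n).1 i

theorem vBigO_V_sub (ht : t₀ < t₁) :
    VBigO (Set.Icc t₀ t₁) ε 1 (fun (p : 𝓓) t => p.V t - d • p.F₀) :=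
  fun i n => (upTo_integrate ht fun i => vBigO_V'' ht i n).2 i

theorem vBigO_V (ht : t₀ < t₁) : VBigO (Set.Icc t₀ t₁) ε 0 (V : 𝓓 → ℝ → E3) :=
  (((vBigO_V_sub ht).weaken (fun p => p.ε_mem) zero_le_one).add vBigO_D).congr
    fun p t _ => by simp

theorem abs_D_apply_le (p : 𝓓) (i : Fin 3) : |(d • p.F₀) i| ≤ |d| + 1 := by
  rw [Pi.smul_apply, smul_eq_mul, abs_mul]
  have := mul_le_mul_of_nonneg_left (p.abs_F₀_apply_le i) (abs_nonneg d)
  linarith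

/-- The acceleration agrees to first order with the linearization. -/
theorem vBigO_V''_sub (ht : t₀ < t₁) :
    VBigO (Set.Icc t₀ t₁) ε 2 (fun (p : 𝓓) t => p.V'' t - p.h • p.W t) := by
  refine VBigO.of_linear_ode (r := fun p t => p.V'' t ⨯₃ (p.V t - d • p.F₀))
    (c := fun p => d • p.F₀) (fun p => p.ε_mem.1) (N := |d| + 1) (by positivity)
    abs_D_apply_le (fun p => by rw [p.init_V'', sub_self]) (fun p t htI => ?_)
    ((vBigO_V'' ht).cross (vBigO_V_sub ht))
  refine ((p.hasDerivWithinAt_V'' ht htI).sub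
    ((p.hasDerivAt_W t).const_smul p.h).hasDerivWithinAt).congr_deriv ?_
  rw [p.W'_eq]
  simp only [map_sub, map_smul, LinearMap.sub_apply, LinearMap.smul_apply]
  module

theorem vBigO_V'_sub (ht : t₀ < t₁) :
    VBigO (Set.Icc t₀ t₁) ε 2 (fun (p : 𝓓) t => p.V' t - p.h • p.U' t) :=
  VBigO.of_deriv ht.le ⟨0, fun p i => by simp [p.init_V']⟩
    (fun p t htI => (p.hasDerivWithinAt_V' ht htI).sub
      ((p.hasDerivAt_U' t).const_smul p.h).hasDerivWithinAt) (vBigO_V''_sub ht)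

theorem vBigO_V_sub_U (ht : t₀ < t₁) :
    VBigO (Set.Icc t₀ t₁) ε 2 (fun (p : 𝓓) t => p.V t - d • p.F₀ - p.h • p.U t) :=
  VBigO.of_deriv ht.le ⟨0, fun p i => by simp [p.init_V]⟩
    (fun p t htI => ((p.hasDerivWithinAt_V ht htI).sub_const _).sub
      ((p.hasDerivAt_U t).const_smul p.h).hasDerivWithinAt) (vBigO_V'_sub ht)

/-- The acceleration agrees to second order with the closed form. -/
theorem vBigO_V''_sub_Y (ht : t₀ < t₁) (hd : d ≠ 0) :
    VBigO (Set.Icc t₀ t₁) ε 3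
      (fun (p : 𝓓) t => p.V'' t - p.h • p.W t - (p.h ^ 2 / 2) • p.Y t) := by
  refine VBigO.of_linear_ode (r := fun p t => p.V'' t ⨯₃ (p.V t - d • p.F₀ - p.h • p.U t) +
      (p.V'' t - p.h • p.W t) ⨯₃ (p.h • p.U t))
    (c := fun p => d • p.F₀) (fun p => p.ε_mem.1) (N := |d| + 1) (by positivity)
    abs_D_apply_le (fun p => by rw [p.init_V'', p.Y_initial]; simp) (fun p t htI => ?_)
    (((vBigO_V'' ht).cross (vBigO_V_sub_U ht)).add
      ((vBigO_V''_sub ht).cross (VBigO.smul bigO_h (vBigO_U ht.le))))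
  refine (((p.hasDerivWithinAt_V'' ht htI).sub
    ((p.hasDerivAt_W t).const_smul p.h).hasDerivWithinAt).sub
    ((p.hasDerivAt_Y hd t).const_smul (p.h ^ 2 / 2)).hasDerivWithinAt).congr_deriv ?_
  rw [p.W'_eq]
  simp only [map_sub, map_smul, LinearMap.sub_apply, LinearMap.smul_apply]
  module

/-- The velocity of the second variation. -/
noncomputable def Z' (p : 𝓓) (t : ℝ) : E3 := ∫ s in t₀..t, p.Y s

/-- The second variation. -/
noncomputable def Z (p : 𝓓) (t : ℝ) : E3 := ∫ s in t₀..t, p.Z' s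

theorem hasDerivAt_Z' (hd : d ≠ 0) (p : 𝓓) (t : ℝ) : HasDerivAt p.Z' (p.Y t) t := by
  have hc : Continuous p.Y :=
    continuous_iff_continuousAt.2 fun t => (p.hasDerivAt_Y hd t).continuousAt
  exact hc.integral_hasStrictDerivAt t₀ t |>.hasDerivAt

theorem hasDerivAt_Z (hd : d ≠ 0) (p : 𝓓) (t : ℝ) : HasDerivAt p.Z (p.Z' t) t := by
  have hc : Continuous p.Z' :=
    continuous_iff_continuousAt.2 fun t => (p.hasDerivAt_Z' hd t).continuousAt
  exact hc.integral_hasStrictDerivAt t₀ t |>.hasDerivAt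

/-- Expansion of the Lie quadratic to second order. -/
theorem vBigO_V_sub_Z (ht : t₀ < t₁) (hd : d ≠ 0) :
    VBigO (Set.Icc t₀ t₁) ε 3
      (fun (p : 𝓓) t => p.V t - d • p.F₀ - p.h • p.U t - (p.h ^ 2 / 2) • p.Z t) := by
  have h : VBigO (Set.Icc t₀ t₁) ε 3
      (fun (p : 𝓓) t => p.V' t - p.h • p.U' t - (p.h ^ 2 / 2) • p.Z' t) :=
    VBigO.of_deriv ht.le ⟨0, fun p i => by simp [p.init_V', Z']⟩
    (fun p t htI => ((p.hasDerivWithinAt_V' ht htI).sub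
      ((p.hasDerivAt_U' t).const_smul p.h).hasDerivWithinAt).sub
      ((p.hasDerivAt_Z' hd t).const_smul (p.h ^ 2 / 2)).hasDerivWithinAt)
      (vBigO_V''_sub_Y ht hd)
  exact VBigO.of_deriv ht.le ⟨0, fun p i => by simp [p.init_V, Z]⟩
    (fun p t htI => (((p.hasDerivWithinAt_V ht htI).sub_const _).sub
      ((p.hasDerivAt_U t).const_smul p.h).hasDerivWithinAt).sub
      ((p.hasDerivAt_Z hd t).const_smul (p.h ^ 2 / 2)).hasDerivWithinAt) h

end Bounds

end Datum

/-! ### The first two variations -/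

/-- A leading coefficient vanishes if the quotient by `h ^ n` tends to `0` and the remainder is of
order `n + 1`. -/
theorem eq_zero_of_tendsto_smul {E : Type*} [NormedAddCommGroup E] [NormedSpace ℝ E] {n : ℕ}
    {g : ℝ → E} {z : E} {K : ℝ}
    (hg : ∀ h ∈ Set.Icc (-1 : ℝ) 1, ‖g h‖ ≤ K * |h| ^ (n + 1))
    (hz : Filter.Tendsto (fun h : ℝ => (h ^ n)⁻¹ • (h ^ n • z + g h))
      (nhdsWithin 0 (Set.Icc (-1) 1)) (nhds 0)) : z = 0 := by
  have hle : nhdsWithin (0 : ℝ) (Set.Ioo 0 1) ≤ nhdsWithin 0 (Set.Icc (-1) 1) :=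
    nhdsWithin_mono _ fun x hx => ⟨by linarith [hx.1], hx.2.le⟩
  have : (nhdsWithin (0 : ℝ) (Set.Ioo 0 1)).NeBot := by
    rw [nhdsWithin_Ioo_eq_nhdsGT one_pos]; infer_instance
  have h1 := hz.mono_left hle
  have h2 : Filter.Tendsto (fun h : ℝ => (h ^ n)⁻¹ • g h) (nhdsWithin 0 (Set.Ioo 0 1))
      (nhds 0) := by
    have h3 : Filter.Tendsto (fun h : ℝ => K * |h|) (nhdsWithin 0 (Set.Ioo 0 1)) (nhds 0) := by
      have : Continuous fun h : ℝ => K * |h| := by fun_prop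
      simpa using (this.tendsto 0).mono_left nhdsWithin_le_nhds
    refine squeeze_zero_norm' ?_ h3
    filter_upwards [self_mem_nhdsWithin] with h hh
    have hp : 0 < h ^ n := pow_pos hh.1 n
    have := hg h ⟨by linarith [hh.1], hh.2.le⟩
    rw [norm_smul, norm_inv, Real.norm_of_nonneg hp.le, inv_mul_le_iff₀ hp]
    refine this.trans_eq ?_
    rw [abs_of_pos hh.1]; ring
  have h4 : Filter.Tendsto (fun h : ℝ => (h ^ n)⁻¹ • (h ^ n • z + g h))
      (nhdsWithin 0 (Set.Ioo 0 1)) (nhds (z + 0)) := by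
    refine (h2.const_add z).congr' ?_
    filter_upwards [self_mem_nhdsWithin] with h hh
    have hp : h ^ n ≠ 0 := (pow_pos hh.1 n).ne'
    rw [smul_add, inv_smul_smul₀ hp]
  simpa using tendsto_nhds_unique h4 h1

/-- The coefficients of a second order expansion of a smooth function are its derivatives. -/
theorem iteratedDerivWithin_eq_of_expansion {E : Type*} [NormedAddCommGroup E]
    [NormedSpace ℝ E] {f : ℝ → E} (hf : ContDiffOn ℝ ∞ f (Set.Icc (-1) 1)) {a b c : E} {K : ℝ}
    (h : ∀ h ∈ Set.Icc (-1 : ℝ) 1, ‖f h - a - h • b - (h ^ 2 / 2) • c‖ ≤ K * |h| ^ 3) :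
    iteratedDerivWithin 1 f (Set.Icc (-1) 1) 0 = b ∧
      iteratedDerivWithin 2 f (Set.Icc (-1) 1) 0 = c := by
  have h0 : (0 : ℝ) ∈ Set.Icc (-1 : ℝ) 1 := by constructor <;> norm_num
  have ha : f 0 = a := by
    have := h 0 h0
    simpa [sub_eq_zero] using this
  have t1 := taylor_tendsto (n := 1) (convex_Icc (-1 : ℝ) 1) h0 (hf.of_le (by simp))
  have t2 := taylor_tendsto (n := 2) (convex_Icc (-1 : ℝ) 1) h0 (contDiffOn_infty.1 hf 2)
  have hb : iteratedDerivWithin 1 f (Set.Icc (-1) 1) 0 = b := by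
    have : b - iteratedDerivWithin 1 f (Set.Icc (-1) 1) 0 = 0 := by
      refine eq_zero_of_tendsto_smul (n := 1) (K := K + ‖c‖)
        (g := fun h => f h - a - h • b - (h ^ 2 / 2) • c + (h ^ 2 / 2) • c) (fun s hs => ?_)
        (t1.congr fun s => ?_)
      · refine (norm_add_le _ _).trans ?_
        have h1 := h s hs
        have h2 : |s| ≤ 1 := abs_le.2 hs
        have hK : 0 ≤ K := by
          have := (norm_nonneg _).trans (h 1 (by constructor <;> norm_num))
          simpa using this
        have h3 : |s| ^ 3 ≤ |s| ^ 2 := pow_le_pow_of_le_one (abs_nonneg _) h2 (by norm_num)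
        have h4 : ‖(s ^ 2 / 2) • c‖ ≤ ‖c‖ * |s| ^ 2 := by
          rw [norm_smul, Real.norm_of_nonneg (by positivity), sq_abs]
          nlinarith [norm_nonneg c, mul_nonneg (sq_nonneg s) (norm_nonneg c)]
        have h5 := mul_le_mul_of_nonneg_left h3 hK
        calc _ ≤ K * |s| ^ 3 + ‖c‖ * |s| ^ 2 := add_le_add h1 h4
          _ ≤ _ := by rw [add_mul]; exact add_le_add h5 le_rfl
      · rw [taylorWithinEval_succ, taylor_within_zero_eval, ha]
        simp
        module
    exact (sub_eq_zero.1 this).symm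
  refine ⟨hb, ?_⟩
  have : (1 / 2 : ℝ) • (c - iteratedDerivWithin 2 f (Set.Icc (-1) 1) 0) = 0 := by
    refine eq_zero_of_tendsto_smul (n := 2) h (t2.congr fun s => ?_)
    rw [taylorWithinEval_succ, taylorWithinEval_succ, taylor_within_zero_eval, ha]
    simp only [Nat.reduceAdd, hb]
    simp
    module
  rw [smul_eq_zero] at this
  exact (sub_eq_zero.1 (this.resolve_left (by norm_num))).symm

theorem iteratedDerivWithin_two_eq {E : Type*} [NormedAddCommGroup E] [NormedSpace ℝ E]
    {f f' f'' : ℝ → E} {I : Set ℝ} (hI : UniqueDiffOn ℝ I)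
    (h1 : ∀ t ∈ I, HasDerivWithinAt f (f' t) I t)
    (h2 : ∀ t ∈ I, HasDerivWithinAt f' (f'' t) I t) {t : ℝ} (ht : t ∈ I) :
    iteratedDerivWithin 2 f I t = f'' t := by
  rw [iteratedDerivWithin_succ', iteratedDerivWithin_one,
    derivWithin_congr (fun s hs => (h1 s hs).derivWithin (hI s hs))
      ((h1 t ht).derivWithin (hI t ht))]
  exact (h2 t ht).derivWithin (hI t ht)

namespace Datum

variable {t₀ t₁ d a₁₁ a₁₂ β c₂ M : ℝ}

local notation "𝓓" => Datum t₀ t₁ d a₁₁ a₁₂ β c₂ M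

theorem firstVar_eq (p : 𝓓) (t : ℝ) :
    firstVar t₀ d p.c₀ p.c₁ c₂ p.F₀ (p.fr 0 p.a₀₁ p.a₀₂) (p.fr 0 a₁₁ a₁₂)
      (p.fr 0 (β * Real.cos p.γ) (β * Real.sin p.γ)) t = p.U t := by
  rw [firstVar, fr, fr, fr, rot_frame p.dot₀ p.dot₁ p.dot₀₁, U, fr, y₁, y₂, osc, osc]
  simp only [frame]
  module

theorem approxAccel_eq (p : 𝓓) (δ t : ℝ) :
    approxAccel t₀ d p.c₀ p.c₁ c₂ p.F₀ (p.fr 0 p.a₀₁ p.a₀₂) (p.fr 0 a₁₁ a₁₂)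
      (p.fr 0 (β * Real.cos p.γ) (β * Real.sin p.γ)) δ t
      = δ • p.W t + (δ ^ 2 / 2) • p.Y t := by
  have hrot : ∀ x y, rot p.F₀ (d * (t - t₀)) (p.fr 0 x y) =
      p.fr 0 (osc d t₀ x y t) (osc d t₀ y (-x) t) := fun x y =>
    rot_frame p.dot₀ p.dot₁ p.dot₀₁ _ _ _ _
  have hsub : ∀ x y z x' y' z', p.fr x y z - p.fr x' y' z' = p.fr (x - x') (y - y') (z - z') :=
    fun _ _ _ _ _ _ => frame_sub ..
  have hF : ∀ x y z, p.F₀ ⨯₃ p.fr x y z = p.fr 0 (-z) y := fun x y z => by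
    rw [p.F₀_eq, fr_cross]; congr 1 <;> ring
  have hFd : ∀ x y z, p.F₀ ⬝ᵥ p.fr x y z = x := fun x y z => by
    rw [p.F₀_eq, fr_dot]; ring
  have hy₁ : osc d t₀ (β * Real.cos p.γ) (β * Real.sin p.γ) t = p.y₁ t := rfl
  have hy₂ : osc d t₀ (β * Real.sin p.γ) (-(β * Real.cos p.γ)) t = p.y₂ t := rfl
  have hs : ∀ x : ℝ, x • p.F₀ = p.fr x 0 0 := fun x => by
    rw [p.F₀_eq, fr_smul]; simp
  rw [approxAccel, f2dd, v2dd]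
  simp only [hrot, hsub, hF, fr_smul, fr_cross, fr_add, hFd, hy₁, hy₂, hs, W, Y]
  congr 1 <;> ring

variable {V : ℝ → ℝ → E3} {F₀ : E3} {U Z : ℝ → E3}

/-- The variations of order one and two. They are read off from the second order expansion of
the Lie quadratics in the perturbation, which avoids exchanging partial derivatives. -/
theorem variation_eq (ht : t₀ < t₁) (hd : d ≠ 0)
    (hV : ContDiffOn ℝ ∞ (fun p : ℝ × ℝ => V p.1 p.2) (Set.Icc (-1) 1 ×ˢ Set.Icc t₀ t₁))
    (P : Set.Icc (-1 : ℝ) 1 → 𝓓) (hh : ∀ s, (P s).h = s) (hPV : ∀ s, (P s).V = V s)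
    (hF₀ : ∀ s, (P s).F₀ = F₀) (hU : ∀ s, (P s).U = U) (hZ : ∀ s, (P s).Z = Z)
    {t : ℝ} (htI : t ∈ Set.Icc t₀ t₁) :
    iteratedDerivWithin 1 (fun h => V h t) (Set.Icc (-1) 1) 0 = U t ∧
      iteratedDerivWithin 2 (fun h => V h t) (Set.Icc (-1) 1) 0 = Z t := by
  obtain ⟨K, hK⟩ := (vBigO_V_sub_Z (t₀ := t₀) (t₁ := t₁) (d := d) (a₁₁ := a₁₁) (a₁₂ := a₁₂)
    (β := β) (c₂ := c₂) (M := M) ht hd).norm_bound fun p => p.ε_mem.1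
  refine iteratedDerivWithin_eq_of_expansion (a := d • F₀) (K := K) ?_ fun h hI => ?_
  · exact hV.comp (f := fun h : ℝ => (h, t)) (by fun_prop) fun h hI => ⟨hI, htI⟩
  · have := hK (P ⟨h, hI⟩) t htI
    rwa [hh, hPV, hF₀, hU, hZ, ε, hh] at this

theorem approxQuadratic_two_eq (p : 𝓓) (h0 : ∀ t ∈ Set.Icc t₀ t₁, V 0 t = d • p.F₀)
    (hv : ∀ t ∈ Set.Icc t₀ t₁,
      iteratedDerivWithin 1 (fun h => V h t) (Set.Icc (-1) 1) 0 = p.U t ∧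
      iteratedDerivWithin 2 (fun h => V h t) (Set.Icc (-1) 1) 0 = p.Z t) (δ : ℝ)
    {t : ℝ} (htI : t ∈ Set.Icc t₀ t₁) :
    approxQuadratic V 2 δ t = d • p.F₀ + δ • p.U t + (δ ^ 2 / 2) • p.Z t := by
  rw [approxQuadratic, show Finset.Icc 1 2 = {1, 2} from rfl, Finset.sum_pair (by norm_num),
    h0 t htI, (hv t htI).1, (hv t htI).2]
  simp [add_assoc]

theorem accel2_eq (ht : t₀ < t₁) (hd : d ≠ 0) (p : 𝓓)
    (h0 : ∀ t ∈ Set.Icc t₀ t₁, V 0 t = d • p.F₀)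
    (hv : ∀ t ∈ Set.Icc t₀ t₁,
      iteratedDerivWithin 1 (fun h => V h t) (Set.Icc (-1) 1) 0 = p.U t ∧
      iteratedDerivWithin 2 (fun h => V h t) (Set.Icc (-1) 1) 0 = p.Z t) (δ : ℝ)
    {t : ℝ} (htI : t ∈ Set.Icc t₀ t₁) :
    accel2 t₀ t₁ V δ t = δ • p.W t + (δ ^ 2 / 2) • p.Y t := by
  rw [accel2, iteratedDerivWithin_congr
    (fun s hs => p.approxQuadratic_two_eq h0 hv δ hs) htI]
  refine iteratedDerivWithin_two_eq (uniqueDiffOn_Icc ht)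
    (f' := fun t => δ • p.U' t + (δ ^ 2 / 2) • p.Z' t)
    (f'' := fun t => δ • p.W t + (δ ^ 2 / 2) • p.Y t) (fun s _ => ?_) (fun s _ => ?_) htI
  · exact ((((p.hasDerivAt_U s).const_smul δ).const_add _).add
      ((p.hasDerivAt_Z hd s).const_smul (δ ^ 2 / 2))).hasDerivWithinAt
  · exact (((p.hasDerivAt_U' s).const_smul δ).add
      ((p.hasDerivAt_Z' hd s).const_smul (δ ^ 2 / 2))).hasDerivWithinAt

end Datum

/-! ### Moving frames in `SO(3)` -/

theorem len_sq (v : E3) : len v ^ 2 = v ⬝ᵥ v := Real.sq_sqrt (dot_self_nonneg v)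

theorem len_pos {v : E3} (hv : 0 < v ⬝ᵥ v) : 0 < len v := Real.sqrt_pos.2 hv

theorem len_smul {a : ℝ} (ha : 0 ≤ a) (v : E3) : len (a • v) = a * len v := by
  rw [len, len, smul_dotProduct, dotProduct_smul, smul_smul, smul_eq_mul,
    Real.sqrt_mul (mul_self_nonneg a), Real.sqrt_mul_self ha]

theorem area_eq (u v : E3) : area u v = len (u ⨯₃ v) := by
  rw [area, len_sq, len_sq, len, cross_dot_cross, dotProduct_comm v u, pow_two]

/-- The rows of `S u v` are `e₁ × e₂, e₁, e₂` for the directions `e₁` of `u × v` and `e₂` of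
`u`. -/
theorem S_eq (u v : E3) : S u v =
    Matrix.of ![((1 / len (u ⨯₃ v)) • (u ⨯₃ v)) ⨯₃ ((1 / len u) • u),
      (1 / len (u ⨯₃ v)) • (u ⨯₃ v), (1 / len u) • u] := by
  rw [S, area_eq]
  congr 2
  rw [len_sq, map_smul, map_smul, LinearMap.smul_apply, cross_cross_eq_smul_sub_smul,
    smul_smul, dotProduct_comm v u]
  congr 1
  rw [one_div_mul_one_div]

theorem unit_smul {a : ℝ} (ha : 0 < a) (v : E3) :
    (1 / len (a • v)) • a • v = (1 / len v) • v := by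
  rw [len_smul ha.le, smul_smul]
  congr 1
  rw [one_div, one_div, mul_inv, mul_comm, mul_inv_cancel_left₀ ha.ne']

/-- `S` is invariant under scaling both vectors by the same positive factor. -/
theorem S_smul {a : ℝ} (ha : 0 < a) (u v : E3) : S (a • u) (a • v) = S u v := by
  have h2 : (a • u) ⨯₃ (a • v) = (a * a) • (u ⨯₃ v) := by simp [smul_smul]
  rw [S_eq, S_eq, h2, unit_smul ha, unit_smul (mul_pos ha ha)]

theorem of_cross_mem {u v : E3} (hu : u ⬝ᵥ u = 1) (hv : v ⬝ᵥ v = 1) (huv : u ⬝ᵥ v = 0) :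
    Matrix.of ![u ⨯₃ v, u, v] ∈ Matrix.specialOrthogonalGroup (Fin 3) ℝ := by
  have hvu : v ⬝ᵥ u = 0 := by rw [dotProduct_comm, huv]
  have hcc : u ⨯₃ v ⬝ᵥ u ⨯₃ v = 1 := by rw [cross_dot_cross, hu, hv, huv, hvu]; ring
  have h1 : u ⬝ᵥ u ⨯₃ v = 0 := dot_self_cross _ _
  have h2 : v ⬝ᵥ u ⨯₃ v = 0 := dot_cross_self _ _
  rw [Matrix.mem_specialOrthogonalGroup_iff, Matrix.mem_orthogonalGroup_iff]
  constructor
  · ext i j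
    have : (Matrix.of ![u ⨯₃ v, u, v] * (Matrix.of ![u ⨯₃ v, u, v])ᵀ) i j =
        (![u ⨯₃ v, u, v] i) ⬝ᵥ (![u ⨯₃ v, u, v] j) := by
      simp [Matrix.mul_apply, dotProduct]
    rw [this]
    fin_cases i <;> fin_cases j <;>
      simp [hu, hv, huv, hvu, hcc, h1, h2,
        dotProduct_comm (u ⨯₃ v) u, dotProduct_comm (u ⨯₃ v) v]
  · change Matrix.det ![u ⨯₃ v, u, v] = 1
    rw [← triple_product_eq_det, hcc]

theorem unit_dot_self {u : E3} (hu : 0 < u ⬝ᵥ u) :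
    ((1 / len u) • u) ⬝ᵥ ((1 / len u) • u) = 1 := by
  have h := len_pos hu
  rw [smul_dotProduct, dotProduct_smul, ← len_sq, smul_eq_mul, smul_eq_mul]
  field_simp

theorem dot_self_pos_of_cross {u v : E3} (h : 0 < u ⨯₃ v ⬝ᵥ u ⨯₃ v) : 0 < u ⬝ᵥ u := by
  refine (dot_self_nonneg u).lt_of_ne fun h0 => h.ne' ?_
  rw [dotProduct_self_eq_zero.1 h0.symm]; simp

/-- Linear independence of `u, v`, expressed by their cross product, puts `S u v` into `SO(3)`. -/
theorem S_mem {u v : E3} (h : 0 < u ⨯₃ v ⬝ᵥ u ⨯₃ v) :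
    S u v ∈ Matrix.specialOrthogonalGroup (Fin 3) ℝ := by
  rw [S_eq]
  refine of_cross_mem (unit_dot_self h) (unit_dot_self (dot_self_pos_of_cross h)) ?_
  rw [smul_dotProduct, dotProduct_smul, dotProduct_comm, dot_self_cross]
  simp

theorem R_mem (r : ℝ) : R r ∈ Matrix.specialOrthogonalGroup (Fin 3) ℝ := by
  have h := Real.sin_sq_add_cos_sq r
  rw [Matrix.mem_specialOrthogonalGroup_iff, Matrix.mem_orthogonalGroup_iff]
  constructor
  · ext i j
    fin_cases i <;> fin_cases j <;> simp [R, Matrix.mul_apply, Fin.sum_univ_three] <;>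
      linarith
  · rw [R, Matrix.det_fin_three]
    simp
    linarith

/-- The rows of `A * ad v` are the cross products of the rows of `A` with `v`. -/
theorem mul_ad_apply (A : M3) (v : E3) (i k : Fin 3) : (A * ad v) i k = (A i ⨯₃ v) k := by
  fin_cases k <;> simp [Matrix.mul_apply, ad, cross_apply, Fin.sum_univ_three] <;> ring

/-- Entrywise differentiability of a curve of matrices, which avoids the choice of a matrix norm. -/
def HasMatrixDerivWithinAt (X : ℝ → M3) (X' : M3) (I : Set ℝ) (t : ℝ) : Prop :=
  ∀ i k, HasDerivWithinAt (fun s => X s i k) (X' i k) I t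

theorem HasMatrixDerivWithinAt.mul {X Y : ℝ → M3} {X' Y' : M3} {I : Set ℝ} {t : ℝ}
    (hX : HasMatrixDerivWithinAt X X' I t) (hY : HasMatrixDerivWithinAt Y Y' I t) :
    HasMatrixDerivWithinAt (fun s => X s * Y s) (X' * Y t + X t * Y') I t := by
  intro i k
  simp only [Matrix.mul_apply, Matrix.add_apply, Fin.sum_univ_three]
  refine ((((hX i 0).fun_mul (hY 0 k)).fun_add ((hX i 1).fun_mul (hY 1 k))).fun_add
    ((hX i 2).fun_mul (hY 2 k))).congr_deriv ?_
  ring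

theorem HasMatrixDerivWithinAt.const_mul (A : M3) {Y : ℝ → M3} {Y' : M3} {I : Set ℝ} {t : ℝ}
    (hY : HasMatrixDerivWithinAt Y Y' I t) :
    HasMatrixDerivWithinAt (fun s => A * Y s) (A * Y') I t := by
  have h : HasMatrixDerivWithinAt (fun _ => A) 0 I t := fun i k => hasDerivWithinAt_const _ _ _
  simpa using h.mul hY

/-- The derivative of the direction of a curve of vectors. -/
theorem hasDerivWithinAt_unit {u : ℝ → E3} {u' : E3} {I : Set ℝ} {t : ℝ}
    (hu : HasDerivWithinAt u u' I t) (h0 : 0 < u t ⬝ᵥ u t) :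
    HasDerivWithinAt (fun s => (1 / len (u s)) • u s)
      ((1 / len (u t)) • u' - (1 / len (u t) ^ 3 * (u t ⬝ᵥ u')) • u t) I t := by
  have hl := len_pos h0
  have h1 : HasDerivWithinAt (fun s => len (u s)) ((u t ⬝ᵥ u') / len (u t)) I t := by
    refine ((hasDerivWithinAt_dot hu hu).sqrt h0.ne').congr_deriv ?_
    rw [dotProduct_comm u', ← len]
    field_simp
    ring
  have h2 := (h1.fun_inv hl.ne').fun_smul hu
  simp only [one_div]
  refine h2.congr_deriv ?_
  match_scalars <;> field_simp

section Kinematics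

variable {I : Set ℝ} {w w' : ℝ → E3} {w'' : E3} {φ : ℝ → ℝ} {φ' t : ℝ}

/-- The left Lie reduction of `R φ * S w w'`: it depends on `w, w', w''` and on `φ'`. -/
noncomputable def frameVelocity (w w' w'' : E3) (φ' : ℝ) : E3 :=
  -((w ⬝ᵥ w)⁻¹ • (w ⨯₃ w')) -
    (φ' * (len w)⁻¹ + (w'' ⬝ᵥ w ⨯₃ w') * (w ⨯₃ w' ⬝ᵥ w ⨯₃ w')⁻¹) • w

/-- The phase rotates the frame about its last row `w / ‖w‖`. -/
theorem frameVelocity_eq (w w' w'' : E3) (φ' : ℝ) :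
    frameVelocity w w' w'' φ' = frameVelocity w w' w'' 0 - φ' • ((1 / len w) • w) := by
  simp only [frameVelocity, one_div]
  module

/-- The last row `w / ‖w‖` of `S w w'` moves with the velocity of the frame without phase. -/
theorem hasDerivWithinAt_direction (hw : HasDerivWithinAt w (w' t) I t)
    (h0 : 0 < w t ⬝ᵥ w t) :
    HasDerivWithinAt (fun s => (1 / len (w s)) • w s)
      (((1 / len (w t)) • w t) ⨯₃ frameVelocity (w t) (w' t) w'' 0) I t := by
  refine (hasDerivWithinAt_unit hw h0).congr_deriv ?_
  have hl := len_pos h0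
  simp only [frameVelocity, map_sub, map_neg, map_smul, LinearMap.smul_apply, cross_self,
    cross_cross_eq_smul_sub_smul', ← len_sq]
  match_scalars <;> field_simp

/-- The middle row of `S w w'` moves with the velocity of the frame without phase. -/
theorem hasDerivWithinAt_binormal (hw : HasDerivWithinAt w (w' t) I t)
    (hw' : HasDerivWithinAt w' w'' I t) (h0 : 0 < w t ⨯₃ w' t ⬝ᵥ w t ⨯₃ w' t) :
    HasDerivWithinAt (fun s => (1 / len (w s ⨯₃ w' s)) • (w s ⨯₃ w' s))
      (((1 / len (w t ⨯₃ w' t)) • (w t ⨯₃ w' t)) ⨯₃ frameVelocity (w t) (w' t) w'' 0) I t := by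
  have hc := hasDerivWithinAt_cross hw hw'
  rw [cross_self, zero_add] at hc
  refine (hasDerivWithinAt_unit hc h0).congr_deriv ?_
  have hl := len_pos h0
  -- Both sides are `c × ((u × z) × c)` for `c = u × v`, as `(u × z) × (u × v)` is parallel to `u`.
  have key : ∀ u v z : E3, (u ⨯₃ v ⬝ᵥ u ⨯₃ v) • (u ⨯₃ z) - (u ⨯₃ v ⬝ᵥ u ⨯₃ z) • (u ⨯₃ v) =
      -((z ⬝ᵥ u ⨯₃ v) • ((u ⨯₃ v) ⨯₃ u)) := by
    intro u v z
    ext i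
    fin_cases i <;> simp [cross_apply, dotProduct, Fin.sum_univ_three] <;> ring
  have key' := key (w t) (w' t) w''
  rw [← len_sq] at key'
  have h3 : (1 / len (w t ⨯₃ w' t)) • (w t ⨯₃ w'') -
      (1 / len (w t ⨯₃ w' t) ^ 3 * (w t ⨯₃ w' t ⬝ᵥ w t ⨯₃ w'')) • (w t ⨯₃ w' t) =
      (1 / len (w t ⨯₃ w' t) ^ 3) • (len (w t ⨯₃ w' t) ^ 2 • (w t ⨯₃ w'') -
        (w t ⨯₃ w' t ⬝ᵥ w t ⨯₃ w'') • (w t ⨯₃ w' t)) := by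
    match_scalars <;> field_simp
  rw [h3, key']
  simp only [frameVelocity, map_sub, map_neg, map_smul, LinearMap.smul_apply, cross_self,
    ← len_sq (w t ⨯₃ w' t)]
  match_scalars
  field_simp
  ring

/-- The frame `R φ * S w w'` moves with left Lie reduction `frameVelocity`. -/
theorem hasMatrixDerivWithinAt_frame (hw : HasDerivWithinAt w (w' t) I t)
    (hw' : HasDerivWithinAt w' w'' I t) (h0 : 0 < w t ⨯₃ w' t ⬝ᵥ w t ⨯₃ w' t)
    (hφ : HasDerivWithinAt φ φ' I t) :
    HasMatrixDerivWithinAt (fun s => R (φ s) * S (w s) (w' s))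
      (R (φ t) * S (w t) (w' t) * ad (frameVelocity (w t) (w' t) w'' φ')) I t := by
  set Ω := frameVelocity (w t) (w' t) w'' 0 with hΩ
  have h2 := hasDerivWithinAt_direction (w'' := w'') hw (dot_self_pos_of_cross h0)
  have h1 := hasDerivWithinAt_binormal hw hw' h0
  have h3 := hasDerivWithinAt_cross h1 h2
  rw [← hΩ] at h1 h2 h3
  have hvv := unit_dot_self (dot_self_pos_of_cross h0)
  have huu := unit_dot_self h0
  have huv : ((1 / len (w t ⨯₃ w' t)) • (w t ⨯₃ w' t)) ⬝ᵥ ((1 / len (w t)) • w t) = 0 := by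
    rw [smul_dotProduct, dotProduct_smul, dotProduct_comm, dot_self_cross]
    simp
  rw [frameVelocity_eq, ← hΩ]
  simp only [S_eq]
  generalize hu : (fun s => (1 / len (w s ⨯₃ w' s)) • (w s ⨯₃ w' s)) = u at *
  generalize hv : (fun s => (1 / len (w s)) • w s) = v at *
  have hu' : ∀ s, (1 / len (w s ⨯₃ w' s)) • (w s ⨯₃ w' s) = u s := fun s => by rw [← hu]
  have hv' : ∀ s, (1 / len (w s)) • w s = v s := fun s => by rw [← hv]
  simp only [hu', hv'] at *
  have hjac : (u t ⨯₃ Ω) ⨯₃ v t + u t ⨯₃ (v t ⨯₃ Ω) = (u t ⨯₃ v t) ⨯₃ Ω := by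
    ext i
    fin_cases i <;> simp [cross_apply] <;> ring
  rw [hjac] at h3
  have hev : (u t ⨯₃ v t) ⨯₃ v t = -u t := by
    rw [cross_cross_eq_smul_sub_smul, huv, hvv]; simp
  have hrow₀ : ∀ s, (R (φ s) * Matrix.of ![u s ⨯₃ v s, u s, v s]) 0 =
      Real.cos (φ s) • (u s ⨯₃ v s) + Real.sin (φ s) • u s := fun s => by
    ext k; simp [Matrix.mul_apply, R, Fin.sum_univ_three]
  have hrow₁ : ∀ s, (R (φ s) * Matrix.of ![u s ⨯₃ v s, u s, v s]) 1 =
      -Real.sin (φ s) • (u s ⨯₃ v s) + Real.cos (φ s) • u s := fun s => by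
    ext k; simp [Matrix.mul_apply, R, Fin.sum_univ_three]
  have hrow₂ : ∀ s, (R (φ s) * Matrix.of ![u s ⨯₃ v s, u s, v s]) 2 = v s := fun s => by
    ext k; simp [Matrix.mul_apply, R, Fin.sum_univ_three]
  intro i k
  rw [mul_ad_apply]
  revert k
  rw [← hasDerivWithinAt_pi (φ := fun s => (R (φ s) * Matrix.of ![u s ⨯₃ v s, u s, v s]) i)]
  fin_cases i
  · change HasDerivWithinAt (fun s => (R (φ s) * Matrix.of ![u s ⨯₃ v s, u s, v s]) 0)
      ((R (φ t) * Matrix.of ![u t ⨯₃ v t, u t, v t]) 0 ⨯₃ (Ω - φ' • v t)) I t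
    simp only [hrow₀]
    refine ((hφ.cos.fun_smul h3).fun_add (hφ.sin.fun_smul h1)).congr_deriv ?_
    simp only [map_sub, map_add, map_smul, LinearMap.add_apply, LinearMap.smul_apply, hev]
    module
  · change HasDerivWithinAt (fun s => (R (φ s) * Matrix.of ![u s ⨯₃ v s, u s, v s]) 1)
      ((R (φ t) * Matrix.of ![u t ⨯₃ v t, u t, v t]) 1 ⨯₃ (Ω - φ' • v t)) I t
    simp only [hrow₁]
    refine ((hφ.sin.fun_neg.fun_smul h3).fun_add (hφ.cos.fun_smul h1)).congr_deriv ?_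
    simp only [map_sub, map_add, map_smul, LinearMap.add_apply, LinearMap.smul_apply, hev]
    module
  · change HasDerivWithinAt (fun s => (R (φ s) * Matrix.of ![u s ⨯₃ v s, u s, v s]) 2)
      ((R (φ t) * Matrix.of ![u t ⨯₃ v t, u t, v t]) 2 ⨯₃ (Ω - φ' • v t)) I t
    simp only [hrow₂]
    refine h2.congr_deriv ?_
    simp only [map_sub, map_smul, cross_self]
    module

end Kinematics

/-! ### Comparison of the angular velocities -/

theorem BigO.exists_small {ι : Type*} {I : Set ℝ} {ε : ι → ℝ} {f : ι → ℝ → ℝ}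
    (hf : BigO I ε 1 f) (hε : ∀ p, 0 ≤ ε p) {m : ℝ} (hm : 0 < m) :
    ∃ δ > 0, ∀ p, ε p < δ → ∀ t ∈ I, |f p t| ≤ m := by
  obtain ⟨K, hK⟩ := hf.bound
  refine ⟨m / (|K| + 1), by positivity, fun p hp t ht => (hK p t ht).trans ?_⟩
  rw [lt_div_iff₀ (by positivity)] at hp
  rw [pow_one]
  have h1 := mul_le_mul_of_nonneg_right (le_abs_self K) (hε p)
  have h2 := hε p
  nlinarith

namespace Datum

variable {t₀ t₁ d a₁₁ a₁₂ β c₂ M : ℝ}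

local notation "𝓓" => Datum t₀ t₁ d a₁₁ a₁₂ β c₂ M

/-- The derivative of `Y`. -/
noncomputable def Y' (p : 𝓓) (t : ℝ) : E3 := p.Y t ⨯₃ (d • p.F₀) + (2 : ℝ) • (p.W t ⨯₃ p.U t)

/-- The second derivative of the second order approximate quadratic, divided by `h`. -/
noncomputable def acc (p : 𝓓) (t : ℝ) : E3 := p.W t + (p.h / 2) • p.Y t

/-- The derivative of `acc`. -/
noncomputable def acc' (p : 𝓓) (t : ℝ) : E3 := p.W' t + (p.h / 2) • p.Y' t

/-- The second derivative of `acc`. -/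
noncomputable def acc'' (p : 𝓓) (t : ℝ) : E3 :=
  p.W' t ⨯₃ (d • p.F₀) + (p.h / 2) •
    (p.Y' t ⨯₃ (d • p.F₀) + (2 : ℝ) • (p.W' t ⨯₃ p.U t + p.W t ⨯₃ p.U' t))

theorem hasDerivWithinAt_acc (hd : d ≠ 0) (p : 𝓓) (I : Set ℝ) (t : ℝ) :
    HasDerivWithinAt p.acc (p.acc' t) I t :=
  ((p.hasDerivAt_W t).add ((p.hasDerivAt_Y hd t).const_smul (p.h / 2))).hasDerivWithinAt

theorem hasDerivWithinAt_acc' (hd : d ≠ 0) (p : 𝓓) (I : Set ℝ) (t : ℝ) :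
    HasDerivWithinAt p.acc' (p.acc'' t) I t := by
  have hD : HasDerivWithinAt (fun _ : ℝ => d • p.F₀) 0 I t := hasDerivWithinAt_const _ _ _
  have h1 : HasDerivWithinAt p.W' (p.W' t ⨯₃ (d • p.F₀)) I t := by
    have := hasDerivWithinAt_cross (p.hasDerivAt_W t).hasDerivWithinAt hD
    rw [map_zero, add_zero] at this
    exact this.congr (fun s _ => p.W'_eq s) (p.W'_eq t)
  have h2 := hasDerivWithinAt_cross (p.hasDerivAt_Y hd t).hasDerivWithinAt hD
  rw [map_zero, add_zero] at h2
  have h3 := hasDerivWithinAt_cross (I := I) (p.hasDerivAt_W t).hasDerivWithinAt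
    (p.hasDerivAt_U t).hasDerivWithinAt
  exact h1.add ((h2.add (h3.const_smul (2 : ℝ))).const_smul (p.h / 2))

theorem bigO_half_h : BigO (Set.Icc t₀ t₁) ε 1 (fun (p : 𝓓) _ => p.h / 2) := by
  simpa only [div_eq_mul_inv] using bigO_h.mul_zero_right (BigO.real 2⁻¹)

theorem vBigO_Y' (ht : t₀ ≤ t₁) : VBigO (Set.Icc t₀ t₁) ε 0 (Y' : 𝓓 → ℝ → E3) :=
  ((vBigO_Y ht).cross vBigO_D).add (VBigO.smul (BigO.real 2) (vBigO_W.cross (vBigO_U ht)))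

theorem vBigO_acc_sub (ht : t₀ ≤ t₁) :
    VBigO (Set.Icc t₀ t₁) ε 1 (fun (p : 𝓓) t => p.acc t - p.W t) :=
  (VBigO.smul bigO_half_h (vBigO_Y ht)).congr fun p t _ => by simp [acc]

theorem vBigO_acc'_sub (ht : t₀ ≤ t₁) :
    VBigO (Set.Icc t₀ t₁) ε 1 (fun (p : 𝓓) t => p.acc' t - p.W' t) :=
  (VBigO.smul bigO_half_h (vBigO_Y' ht)).congr fun p t _ => by simp [acc']

theorem vBigO_acc (ht : t₀ ≤ t₁) : VBigO (Set.Icc t₀ t₁) ε 0 (acc : 𝓓 → ℝ → E3) :=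
  (((vBigO_acc_sub ht).weaken (fun p => p.ε_mem) zero_le_one).add vBigO_W).congr
    fun p t _ => by simp

theorem vBigO_acc' (ht : t₀ ≤ t₁) : VBigO (Set.Icc t₀ t₁) ε 0 (acc' : 𝓓 → ℝ → E3) :=
  (((vBigO_acc'_sub ht).weaken (fun p => p.ε_mem) zero_le_one).add vBigO_W').congr
    fun p t _ => by simp

/-- The defect of `acc` in the equation `V''' = V'' × V`. -/
noncomputable def defect (p : 𝓓) (t : ℝ) : E3 := p.acc' t - p.acc t ⨯₃ p.V t

/-- The derivative of the defect. -/
noncomputable def defect' (p : 𝓓) (t : ℝ) : E3 :=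
  p.acc'' t - (p.acc' t ⨯₃ p.V t + p.acc t ⨯₃ p.V' t)

/-- The first order terms of the defect cancel by the linearized equation for `Y`. -/
theorem vBigO_defect (ht : t₀ < t₁) : VBigO (Set.Icc t₀ t₁) ε 2 (defect : 𝓓 → ℝ → E3) := by
  refine (((VBigO.smul (bigO_h.mul bigO_half_h) (vBigO_U ht.le)).cross (vBigO_Y ht.le)).sub
    ((vBigO_acc ht.le).cross_zero_left (vBigO_V_sub_U ht))).congr fun p t _ => ?_
  rw [defect, acc', acc, Y', W'_eq]
  rw [← cross_anticomm (p.Y t)]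
  simp only [map_sub, map_add, map_smul, LinearMap.add_apply, LinearMap.smul_apply]
  module

theorem vBigO_defect' (ht : t₀ < t₁) (hd : d ≠ 0) :
    VBigO (Set.Icc t₀ t₁) ε 2 (defect' : 𝓓 → ℝ → E3) :=
  (vBigO_defect ht).deriv (uniqueDiffOn_Icc ht) fun p t htI =>
    (p.hasDerivWithinAt_acc' hd _ t).sub
      (hasDerivWithinAt_cross (p.hasDerivWithinAt_acc hd _ t) (p.hasDerivWithinAt_V ht htI))

theorem W'_dot_W' (p : 𝓓) (t : ℝ) : p.W' t ⬝ᵥ p.W' t = d ^ 6 * β ^ 2 := by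
  rw [W', fr_dot, ← p.y_sq t]; ring

/-- `acc` and `acc'` are orthogonal up to second order, since `acc'` is `acc × V` up to the
defect. -/
theorem bigO_acc_dot_acc' (ht : t₀ < t₁) :
    BigO (Set.Icc t₀ t₁) ε 2 (fun (p : 𝓓) t => p.acc t ⬝ᵥ p.acc' t) :=
  ((vBigO_acc ht.le).dot_zero_left (vBigO_defect ht)).congr fun p t _ => by
    rw [defect, dotProduct_sub, dot_self_cross, sub_zero]

theorem bigO_acc_dot_self (ht : t₀ ≤ t₁) : BigO (Set.Icc t₀ t₁) ε 1
    (fun (p : 𝓓) t => p.acc t ⬝ᵥ p.acc t - (4 * c₂ ^ 2 + d ^ 4 * β ^ 2)) :=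
  (((vBigO_acc ht).dot_zero_left (vBigO_acc_sub ht)).add
    (vBigO_W.dot_zero_left (vBigO_acc_sub ht))).congr fun p t _ => by
      rw [← p.W_dot_W t, dotProduct_sub, dotProduct_sub, dotProduct_comm (p.W t) (p.acc t)]
      ring

theorem bigO_acc'_dot_self (ht : t₀ ≤ t₁) : BigO (Set.Icc t₀ t₁) ε 1
    (fun (p : 𝓓) t => p.acc' t ⬝ᵥ p.acc' t - d ^ 6 * β ^ 2) :=
  (((vBigO_acc' ht).dot_zero_left (vBigO_acc'_sub ht)).add
    (vBigO_W'.dot_zero_left (vBigO_acc'_sub ht))).congr fun p t _ => by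
      rw [← p.W'_dot_W' t, dotProduct_sub, dotProduct_sub, dotProduct_comm (p.W' t) (p.acc' t)]
      ring

/-- Uniform positivity of the lengths of `acc`, `acc'` and of their cross product. -/
def IsNondegenerate (p : 𝓓) : Prop :=
  ∀ t ∈ Set.Icc t₀ t₁,
    (4 * c₂ ^ 2 + d ^ 4 * β ^ 2) / 2 ≤ p.acc t ⬝ᵥ p.acc t ∧
    d ^ 6 * β ^ 2 / 2 ≤ p.acc' t ⬝ᵥ p.acc' t ∧
    (4 * c₂ ^ 2 + d ^ 4 * β ^ 2) * (d ^ 6 * β ^ 2) / 8 ≤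
      p.acc t ⨯₃ p.acc' t ⬝ᵥ p.acc t ⨯₃ p.acc' t

theorem cross_acc_dot_self (p : 𝓓) (t : ℝ) :
    p.acc t ⨯₃ p.acc' t ⬝ᵥ p.acc t ⨯₃ p.acc' t =
      (p.acc t ⬝ᵥ p.acc t) * (p.acc' t ⬝ᵥ p.acc' t) - (p.acc t ⬝ᵥ p.acc' t) ^ 2 := by
  rw [cross_dot_cross, dotProduct_comm (p.acc' t) (p.acc t)]; ring

theorem exists_nondegenerate (ht : t₀ < t₁) (hd : 0 < d) (hβ : 0 < β) :
    ∃ δ₀ : ℝ, 0 < δ₀ ∧ δ₀ ≤ 1 ∧ ∀ p : 𝓓, p.ε < δ₀ → p.IsNondegenerate := by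
  set m := 4 * c₂ ^ 2 + d ^ 4 * β ^ 2 with hm
  set m' := d ^ 6 * β ^ 2 with hm'
  have hmp : 0 < m := by positivity
  have hmp' : 0 < m' := by positivity
  have hε : ∀ p : 𝓓, 0 ≤ p.ε := fun p => p.ε_mem.1
  obtain ⟨δ₁, h₁, H₁⟩ := (bigO_acc_dot_self (a₁₁ := a₁₁) (a₁₂ := a₁₂) (c₂ := c₂) (d := d)
    (β := β) (M := M) ht.le).exists_small hε (half_pos hmp)
  obtain ⟨δ₂, h₂, H₂⟩ := (bigO_acc'_dot_self (a₁₁ := a₁₁) (a₁₂ := a₁₂) (c₂ := c₂) (d := d)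
    (β := β) (M := M) ht.le).exists_small hε (half_pos hmp')
  have hb := (bigO_acc_dot_acc' (a₁₁ := a₁₁) (a₁₂ := a₁₂) (c₂ := c₂) (d := d)
    (β := β) (M := M) ht)
  obtain ⟨δ₃, h₃, H₃⟩ := ((hb.mul hb).weaken (fun p => p.ε_mem)
    (show 1 ≤ 2 + 2 by norm_num)).exists_small hε (show 0 < m * m' / 8 by positivity)
  refine ⟨min (min δ₁ δ₂) (min δ₃ 1), by positivity, (min_le_right _ _).trans (min_le_right _ _),
    fun p hp t htI => ?_⟩
  simp only [lt_min_iff] at hp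
  have g₁ := (abs_le.1 (H₁ p hp.1.1 t htI)).1
  have g₂ := (abs_le.1 (H₂ p hp.1.2 t htI)).1
  have g₃ := (abs_le.1 (H₃ p hp.2.1 t htI)).2
  have g₄ : m / 2 ≤ p.acc t ⬝ᵥ p.acc t := by linarith
  have g₅ : m' / 2 ≤ p.acc' t ⬝ᵥ p.acc' t := by linarith
  refine ⟨g₄, g₅, ?_⟩
  rw [cross_acc_dot_self]
  -- The product is at least `m * m' / 4`, and the square removes at most half of that.
  have := mul_le_mul g₄ g₅ (by positivity) (by linarith)
  nlinarith

/-- The derivative of the approximate phase, divided by `h`. -/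
noncomputable def phaseRate (p : 𝓓) (t : ℝ) : ℝ :=
  Real.sqrt ((-2 * c₂ / (d ^ 2 * β)) ^ 2 + 1) *
    (β + (a₁₁ * p.y₂ t - a₁₂ * p.y₁ t) * (d * β)⁻¹)

theorem hasDerivAt_phase (hd : d ≠ 0) (hβ : β ≠ 0) (p : 𝓓) (t : ℝ) :
    HasDerivAt (phase t₀ d a₁₁ a₁₂ β p.γ c₂ p.h) (p.h * p.phaseRate t) t := by
  have hs := hasDerivAt_sub_initial (t₀ := t₀) t
  have hθ : HasDerivAt (fun t => p.γ - d * (t - t₀)) (-d) t := by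
    simpa using (hs.const_mul d).const_sub p.γ
  refine (((hs.mul_const β).add ((((hθ.cos.sub_const (Real.cos p.γ)).const_mul a₁₁).add
    ((hθ.sin.sub_const (Real.sin p.γ)).const_mul a₁₂)).div_const (d ^ 2))).const_mul
      (p.h * Real.sqrt ((-2 * c₂ / (d ^ 2 * β)) ^ 2 + 1))).congr_deriv ?_
  rw [phaseRate, y₁, y₂, osc, osc, Real.cos_sub, Real.sin_sub]
  field_simp
  ring

theorem bigO_phaseRate : BigO (Set.Icc t₀ t₁) ε 0 (phaseRate : 𝓓 → ℝ → ℝ) :=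
  (BigO.real _).mul ((BigO.real β).add ((((BigO.real a₁₁).mul bigO_y₂).sub
    ((BigO.real a₁₂).mul bigO_y₁)).mul (BigO.real _)))

/-- The identity that dictates the choice of the approximate phase. -/
theorem phaseRate_mul (hd : 0 < d) (hβ : 0 < β) (p : 𝓓) (t : ℝ) :
    p.phaseRate t * (d ^ 6 * β ^ 2) =
      -(Real.sqrt (4 * c₂ ^ 2 + d ^ 4 * β ^ 2) * (p.U' t ⬝ᵥ p.W' t)) := by
  have h1 : Real.sqrt ((-2 * c₂ / (d ^ 2 * β)) ^ 2 + 1) =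
      Real.sqrt (4 * c₂ ^ 2 + d ^ 4 * β ^ 2) / (d ^ 2 * β) := by
    rw [← Real.sqrt_sq (show 0 ≤ d ^ 2 * β by positivity), ← Real.sqrt_div' _ (sq_nonneg _),
      Real.sqrt_sq (show 0 ≤ d ^ 2 * β by positivity)]
    congr 1
    field_simp
    ring
  have h2 := p.y_sq t
  rw [phaseRate, h1, U', W', fr_dot]
  field_simp
  linear_combination -d ^ 4 * h2

/-- `⟨V', acc'⟩` agrees with its first order part up to second order. -/
theorem bigO_V'_dot (ht : t₀ < t₁) : BigO (Set.Icc t₀ t₁) ε 2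
    (fun (p : 𝓓) t => p.V' t ⬝ᵥ p.acc' t - p.h * (p.U' t ⬝ᵥ p.W' t)) :=
  (((vBigO_V'_sub ht).dot (vBigO_acc' ht.le)).add
    (bigO_h.mul ((vBigO_U' ht.le).dot_zero_left (vBigO_acc'_sub ht.le)))).congr fun p t _ => by
      rw [sub_dotProduct, dotProduct_sub, smul_dotProduct, smul_eq_mul]
      ring

/-- The triple product in the angular velocity of the frame, up to second order. -/
theorem bigO_triple (ht : t₀ < t₁) (hd : d ≠ 0) : BigO (Set.Icc t₀ t₁) ε 2
    (fun (p : 𝓓) t => p.acc'' t ⬝ᵥ p.acc t ⨯₃ p.acc' t -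
      (-(p.acc' t ⬝ᵥ p.acc' t) * (p.V t ⬝ᵥ p.acc t) +
        (p.acc t ⬝ᵥ p.acc t) * (p.V' t ⬝ᵥ p.acc' t))) := by
  have hV' := (vBigO_V' (d := d) (a₁₁ := a₁₁) (a₁₂ := a₁₂) (β := β) (c₂ := c₂) (M := M) ht).weaken
    (fun p => p.ε_mem) zero_le_one
  refine (((bigO_acc_dot_acc' ht).mul_zero_right
    (((vBigO_V ht).dot (vBigO_acc' ht.le)).sub (hV'.dot (vBigO_acc ht.le)))).add
    ((vBigO_defect' ht hd).dot ((vBigO_acc ht.le).cross (vBigO_acc' ht.le)))).congr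
      fun p t _ => ?_
  have : p.acc'' t = p.acc' t ⨯₃ p.V t + p.acc t ⨯₃ p.V' t + p.defect' t := by
    rw [defect']; module
  rw [this, add_dotProduct, add_dotProduct, cross_dot_cross, cross_dot_cross,
    dotProduct_comm (p.acc' t) (p.acc t)]
  ring

/-- The data with small positive `h`. -/
abbrev Small (t₀ t₁ d a₁₁ a₁₂ β c₂ M δ₀ : ℝ) : Type :=
  {p : Datum t₀ t₁ d a₁₁ a₁₂ β c₂ M // 0 < p.h ∧ p.h < δ₀}

/-- The component along `acc` of the difference of the angular velocities, rearranged so that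
every summand is visibly of second order. Here `n, n', r` are the squared lengths of `acc`, `acc'`
and their cross product, `m, m'` the limits of `n, n'`, and `a, b, c, N` the inner products
`⟨V, acc⟩`, `⟨V', acc'⟩`, `⟨acc, acc'⟩` and the triple product. -/
theorem bracket_identity {n n' r s s₀ m m' h φ u N a b c : ℝ} (hn : n ≠ 0) (hn' : n' ≠ 0)
    (hr : r ≠ 0) (hs : s ≠ 0) (hss : s + s₀ ≠ 0) (h1 : s ^ 2 = n) (h2 : s₀ ^ 2 = m)
    (h3 : φ * m' = -(s₀ * u)) (h4 : r = n * n' - c ^ 2) :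
    -(n⁻¹ * a) - (h * φ * s⁻¹ + N * r⁻¹) =
      -((h * φ * (n' - m') + h * ((n - m) * (s + s₀)⁻¹) * u + s * (b - h * u)) *
        (s⁻¹ * n'⁻¹)) - (N - (-n' * a + n * b)) * r⁻¹
      - c * c * (-(n' * a) + n * b) * (r⁻¹ * (n⁻¹ * n'⁻¹)) := by
  have e₅ : (n - m) * (s + s₀)⁻¹ = s - s₀ := by
    rw [← h1, ← h2]; field_simp; ring
  have e₃ : h * φ * (n' - m') + h * (s - s₀) * u + s * (b - h * u) = h * φ * n' + s * b := by
    linear_combination -h * h3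
  have hc : c * c = n * n' - r := by rw [h4]; ring
  rw [e₅, e₃, hc]
  field_simp
  ring

/-- The left Lie reduction of the approximate frame agrees with the Lie quadratic up to second
order. -/
theorem vBigO_frameVelocity_sub (ht : t₀ < t₁) (hd : 0 < d) (hβ : 0 < β) {δ₀ : ℝ}
    (hδ₀ : ∀ p : 𝓓, p.ε < δ₀ → p.IsNondegenerate) :
    VBigO (Set.Icc t₀ t₁) (fun q : Small t₀ t₁ d a₁₁ a₁₂ β c₂ M δ₀ => q.1.ε) 2 (fun q t =>
      frameVelocity (q.1.acc t) (q.1.acc' t) (q.1.acc'' t) (q.1.h * q.1.phaseRate t)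
        - q.1.V t) := by
  have hmp : 0 < 4 * c₂ ^ 2 + d ^ 4 * β ^ 2 := by positivity
  have hmp' : 0 < d ^ 6 * β ^ 2 := by positivity
  have hmm : 0 < (4 * c₂ ^ 2 + d ^ 4 * β ^ 2) * (d ^ 6 * β ^ 2) / 8 := by positivity
  let ι := Small t₀ t₁ d a₁₁ a₁₂ β c₂ M δ₀
  let v : ι → 𝓓 := Subtype.val
  have hnd : ∀ q : ι, q.1.IsNondegenerate := fun q =>
    hδ₀ q.1 (by rw [ε, abs_of_pos q.2.1]; exact q.2.2)
  have hw := (vBigO_acc (d := d) (a₁₁ := a₁₁) (a₁₂ := a₁₂) (β := β) (c₂ := c₂) (M := M)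
    ht.le).reindex v
  have hw' := (vBigO_acc' (d := d) (a₁₁ := a₁₁) (a₁₂ := a₁₂) (β := β) (c₂ := c₂) (M := M)
    ht.le).reindex v
  have hV := (vBigO_V (d := d) (a₁₁ := a₁₁) (a₁₂ := a₁₂) (β := β) (c₂ := c₂) (M := M)
    ht).reindex v
  have hV' := ((vBigO_V' (d := d) (a₁₁ := a₁₁) (a₁₂ := a₁₂) (β := β) (c₂ := c₂) (M := M)
    ht).weaken (fun p => p.ε_mem) zero_le_one).reindex v
  have hUW := ((vBigO_U' (d := d) (a₁₁ := a₁₁) (a₁₂ := a₁₂) (β := β) (c₂ := c₂) (M := M)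
    ht.le).dot vBigO_W').reindex v
  have hh := (bigO_h (t₀ := t₀) (t₁ := t₁) (d := d) (a₁₁ := a₁₁) (a₁₂ := a₁₂) (β := β)
    (c₂ := c₂) (M := M)).reindex v
  have hφ := (bigO_phaseRate (t₀ := t₀) (t₁ := t₁) (d := d) (a₁₁ := a₁₁) (a₁₂ := a₁₂) (β := β)
    (c₂ := c₂) (M := M)).reindex v
  have hζ := (vBigO_defect (d := d) (a₁₁ := a₁₁) (a₁₂ := a₁₂) (β := β) (c₂ := c₂) (M := M)
    ht).reindex v
  have e₁ := (bigO_triple (a₁₁ := a₁₁) (a₁₂ := a₁₂) (β := β) (c₂ := c₂) (M := M) ht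
    hd.ne').reindex v
  have e₂ := (bigO_acc_dot_acc' (d := d) (a₁₁ := a₁₁) (a₁₂ := a₁₂) (β := β) (c₂ := c₂) (M := M)
    ht).reindex v
  have e₅ := (bigO_acc_dot_self (d := d) (a₁₁ := a₁₁) (a₁₂ := a₁₂) (β := β) (c₂ := c₂) (M := M)
    ht.le).reindex v
  have e₆ := (bigO_acc'_dot_self (d := d) (a₁₁ := a₁₁) (a₁₂ := a₁₂) (β := β) (c₂ := c₂) (M := M)
    ht.le).reindex v
  have e₇ := (bigO_V'_dot (d := d) (a₁₁ := a₁₁) (a₁₂ := a₁₂) (β := β) (c₂ := c₂) (M := M)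
    ht).reindex v
  have hn := hw.dot hw
  have hn' := hw'.dot hw'
  have hr := (hw.cross hw').dot (hw.cross hw')
  have hni := BigO.inv (half_pos hmp) (fun q t htI => (hnd q t htI).1) hn
  have hni' := BigO.inv (half_pos hmp') (fun q t htI => (hnd q t htI).2.1) hn'
  have hri := BigO.inv hmm (fun q t htI => (hnd q t htI).2.2) hr
  have hs := BigO.sqrt (half_pos hmp) (fun q t htI => (hnd q t htI).1) hn
  have hsi := BigO.inv (Real.sqrt_pos.2 (half_pos hmp))
    (fun q t htI => Real.sqrt_le_sqrt (hnd q t htI).1) hs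
  have hssi := BigO.inv (Real.sqrt_pos.2 hmp)
    (fun q t htI => le_add_of_nonneg_left (Real.sqrt_nonneg _))
    (hs.add (BigO.real (Real.sqrt (4 * c₂ ^ 2 + d ^ 4 * β ^ 2))))
  -- The summand `φ' / ‖acc‖ + ⟨V', acc'⟩ / ‖acc'‖ ^ 2`: its first order term vanishes by
  -- `phaseRate_mul`, which leaves the differences `e₅, e₆, e₇`.
  have e₃ := (((((hh.mul_zero_right hφ).mul e₆).add
    ((hh.mul (e₅.mul_zero_right hssi)).mul_zero_right hUW)).add
      (hs.mul_zero_left e₇)).mul_zero_right (hsi.mul hni'))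
  have hX := ((hn'.mul (hV.dot hw)).neg.add (hn.mul (hV'.dot hw')))
  have hB := (e₃.neg.sub (e₁.mul_zero_right hri)).sub
    ((((e₂.mul e₂).weaken (fun q => q.1.ε_mem) (show 2 ≤ 2 + 2 by norm_num)).mul_zero_right hX
      ).mul_zero_right (hri.mul (hni.mul hni')))
  refine ((VBigO.smul hB hw).sub (VBigO.smul_zero_left hni (hw.cross_zero_left hζ))).congr
    fun q t htI => ?_
  obtain ⟨h1, h2, h3⟩ := hnd q t htI
  have h4 := q.1.cross_acc_dot_self t
  have h5 := q.1.phaseRate_mul hd hβ t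
  have h6 : q.1.acc t ⨯₃ q.1.acc' t = (q.1.acc t ⬝ᵥ q.1.V t) • q.1.acc t
      - (q.1.acc t ⬝ᵥ q.1.acc t) • q.1.V t + q.1.acc t ⨯₃ q.1.defect t := by
    rw [defect, map_sub, cross_cross_eq_smul_sub_smul']
    module
  have g0 : 0 < q.1.acc t ⬝ᵥ q.1.acc t := by linarith
  have g1 : 0 < q.1.acc' t ⬝ᵥ q.1.acc' t := by linarith
  have g2 : 0 < q.1.acc t ⨯₃ q.1.acc' t ⬝ᵥ q.1.acc t ⨯₃ q.1.acc' t := by linarith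
  have g3 := Real.sqrt_pos.2 g0
  have g4 := Real.sq_sqrt g0.le
  have g5 := Real.sqrt_pos.2 hmp
  have g6 := Real.sq_sqrt hmp.le
  have hbr := bracket_identity (h := q.1.h) (N := q.1.acc'' t ⬝ᵥ q.1.acc t ⨯₃ q.1.acc' t)
    (a := q.1.V t ⬝ᵥ q.1.acc t) (b := q.1.V' t ⬝ᵥ q.1.acc' t)
    g0.ne' g1.ne' g2.ne' g3.ne' (add_pos g3 g5).ne' g4 g6 h5 h4
  refine Eq.trans ?_ (congrArg (fun z => z • q.1.acc t - (q.1.acc t ⬝ᵥ q.1.acc t)⁻¹ •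
    (q.1.acc t ⨯₃ q.1.defect t)) hbr)
  have h7 : (q.1.acc t ⬝ᵥ q.1.acc t)⁻¹ • (q.1.acc t ⨯₃ q.1.acc' t) =
      ((q.1.acc t ⬝ᵥ q.1.acc t)⁻¹ * (q.1.V t ⬝ᵥ q.1.acc t)) • q.1.acc t - q.1.V t
        + (q.1.acc t ⬝ᵥ q.1.acc t)⁻¹ • (q.1.acc t ⨯₃ q.1.defect t) := by
    rw [h6, smul_add, smul_sub, smul_smul, inv_smul_smul₀ g0.ne', dotProduct_comm (q.1.V t)]
  rw [frameVelocity, h7, len]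
  module

end Datum

/-! ### Comparison of curves in `SO(3)` -/

section Comparison

variable {ι : Type*} {t₀ t₁ : ℝ} {ε : ι → ℝ} {x y : ι → ℝ → M3} {v w : ι → ℝ → E3}

theorem row_dot_row {A : M3} (hA : A ∈ Matrix.specialOrthogonalGroup (Fin 3) ℝ) (i k : Fin 3) :
    A i ⬝ᵥ A k = (1 : M3) i k := by
  rw [← (Matrix.mem_orthogonalGroup_iff (Fin 3) ℝ).1
    (Matrix.mem_specialOrthogonalGroup_iff.1 hA).1]
  simp [Matrix.mul_apply, dotProduct]

/-- Curves in `SO(3)` whose left Lie reductions are bounded with all derivatives are bounded with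
all derivatives. -/
theorem vBigO_row {I : Set ℝ}
    (hx : ∀ p, ∀ t ∈ I, x p t ∈ Matrix.specialOrthogonalGroup (Fin 3) ℝ)
    (hx' : ∀ p, ∀ t ∈ I, HasMatrixDerivWithinAt (x p) (x p t * ad (v p t)) I t)
    (hv : VBigO I ε 0 v) (i : Fin 3) : VBigO I ε 0 (fun p t => x p t i) := by
  refine BigO.of_bootstrap (f := fun k p t => x p t i k)
    (f' := fun k p t => (x p t i ⨯₃ v p t) k) (fun k => ⟨1, fun p t ht => ?_⟩)
    (fun k p t ht => by rw [← mul_ad_apply]; exact hx' p t ht i k)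
    fun n hn k => BigOUpTo.cross (l := 0) hn (fun k => hv k n) k
  have h1 := sq_apply_le_dot_self (x p t i) k
  rw [row_dot_row (hx p t ht), Matrix.one_apply_eq] at h1
  simpa using abs_le_one_iff_mul_self_le_one.2 (by nlinarith)

/-- Two families of curves in `SO(3)` with the same initial values, whose left Lie reductions
agree up to `O(ε ^ k)`, agree up to `O(ε ^ k)`. The products `x yᵀ` solve a linear equation with
small right hand side and start at `1`. -/
theorem bigO_sub_of_reduction (ht : t₀ < t₁) {k : ℕ}
    (hx : ∀ p, ∀ t ∈ Set.Icc t₀ t₁, x p t ∈ Matrix.specialOrthogonalGroup (Fin 3) ℝ)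
    (hy : ∀ p, ∀ t ∈ Set.Icc t₀ t₁, y p t ∈ Matrix.specialOrthogonalGroup (Fin 3) ℝ)
    (hx' : ∀ p, ∀ t ∈ Set.Icc t₀ t₁,
      HasMatrixDerivWithinAt (x p) (x p t * ad (v p t)) (Set.Icc t₀ t₁) t)
    (hy' : ∀ p, ∀ t ∈ Set.Icc t₀ t₁,
      HasMatrixDerivWithinAt (y p) (y p t * ad (w p t)) (Set.Icc t₀ t₁) t)
    (h0 : ∀ p, x p t₀ = y p t₀) (hv : VBigO (Set.Icc t₀ t₁) ε 0 v)
    (hw : VBigO (Set.Icc t₀ t₁) ε 0 w)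
    (hvw : VBigO (Set.Icc t₀ t₁) ε k (fun p t => w p t - v p t)) (i j : Fin 3) :
    BigO (Set.Icc t₀ t₁) ε k (fun p t => x p t i j - y p t i j) := by
  have bx := vBigO_row hx hx' hv
  have bY := vBigO_row hy hy' hw
  have hrow : ∀ {z : ι → ℝ → M3} {u : ι → ℝ → E3}, (∀ p, ∀ t ∈ Set.Icc t₀ t₁,
      HasMatrixDerivWithinAt (z p) (z p t * ad (u p t)) (Set.Icc t₀ t₁) t) →
      ∀ i p, ∀ t ∈ Set.Icc t₀ t₁,
        HasDerivWithinAt (fun s => z p s i) (z p t i ⨯₃ u p t) (Set.Icc t₀ t₁) t := by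
    intro z u hz i p t ht
    exact hasDerivWithinAt_pi.2 fun k => by rw [← mul_ad_apply]; exact hz p t ht i k
  -- The entries of `x yᵀ`, which are the inner products of the rows.
  have hP : ∀ i j, BigO (Set.Icc t₀ t₁) ε k
      (fun p t => x p t i ⬝ᵥ y p t j - (1 : M3) i j) := by
    intro i j
    refine BigO.of_deriv (f' := fun p t => -((x p t i ⨯₃ (w p t - v p t)) ⬝ᵥ y p t j)) ht.le
      ⟨0, fun p => ?_⟩ (fun p t htI => ?_)
      ((((bx i).cross_zero_left hvw).dot (bY j)).neg)
    · rw [h0, row_dot_row (hy p t₀ (Set.left_mem_Icc.2 ht.le))]; simp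
    · refine ((hasDerivWithinAt_dot (hrow hx' i p t htI) (hrow hy' j p t htI)).sub_const
        _).congr_deriv ?_
      simp [cross_apply, dotProduct, Fin.sum_univ_three]
      ring
  refine ((((hP i 0).mul_zero_right (bY 0 j)).add ((hP i 1).mul_zero_right (bY 1 j))).add
    ((hP i 2).mul_zero_right (bY 2 j))).congr fun p t htI => ?_
  have horth : (y p t)ᵀ * y p t = 1 :=
    (Matrix.mem_orthogonalGroup_iff' (Fin 3) ℝ).1
      (Matrix.mem_specialOrthogonalGroup_iff.1 (hy p t htI)).1
  have h1 : x p t * (y p t)ᵀ * y p t = x p t := by rw [Matrix.mul_assoc, horth, Matrix.mul_one]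
  have h2 : ∀ l, x p t i ⬝ᵥ y p t l = (x p t * (y p t)ᵀ) i l := fun l => by
    simp [Matrix.mul_apply, dotProduct]
  have h3 : ((x p t * (y p t)ᵀ - 1) * y p t) i j = x p t i j - y p t i j := by
    rw [Matrix.sub_mul, h1, Matrix.one_mul, Matrix.sub_apply]
  rw [← h3, Matrix.mul_apply, Fin.sum_univ_three]
  simp only [h2, Matrix.sub_apply]

end Comparison

theorem isRiemannianCubic_reduction {t₀ t₁ : ℝ} {x : ℝ → M3} {V : ℝ → E3}
    (hx : IsRiemannianCubic t₀ t₁ x) (hV : IsLeftLieReduction t₀ t₁ x V) :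
    ∀ t ∈ Set.Icc t₀ t₁, HasMatrixDerivWithinAt x (x t * ad (V t)) (Set.Icc t₀ t₁) t := by
  intro t ht i k
  have hdet : IsUnit (x t).det := by
    rw [(Matrix.mem_specialOrthogonalGroup_iff.1 (hx.1 t ht)).2]; exact isUnit_one
  rw [← hV t ht, Matrix.mul_nonsing_inv_cancel_left _ _ hdet]
  exact ((hx.2.1 i k).differentiableOn (by simp) t ht).hasDerivWithinAt

namespace Datum

variable {t₀ t₁ d a₁₁ a₁₂ β c₂ M δ₀ : ℝ}

local notation "𝓓" => Datum t₀ t₁ d a₁₁ a₁₂ β c₂ M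

/-- The approximate frame `R φ * S (acc) (acc')`. -/
noncomputable def approxFrame (p : 𝓓) (t : ℝ) : M3 :=
  R (phase t₀ d a₁₁ a₁₂ β p.γ c₂ p.h t) * S (p.acc t) (p.acc' t)

/-- The left translate of the approximate frame that starts at `g`. -/
noncomputable def approxCurve (p : 𝓓) (g : M3) (t : ℝ) : M3 :=
  g * (p.approxFrame t₀)ᵀ * p.approxFrame t

/-- The left Lie reduction of the approximate frame. -/
noncomputable def approxVelocity (p : 𝓓) (t : ℝ) : E3 :=
  frameVelocity (p.acc t) (p.acc' t) (p.acc'' t) (p.h * p.phaseRate t)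

theorem IsNondegenerate.cross_pos (hd : 0 < d) (hβ : 0 < β) {p : 𝓓} (hp : p.IsNondegenerate)
    {t : ℝ} (htI : t ∈ Set.Icc t₀ t₁) :
    0 < p.acc t ⨯₃ p.acc' t ⬝ᵥ p.acc t ⨯₃ p.acc' t :=
  lt_of_lt_of_le (by positivity) (hp t htI).2.2

theorem approxFrame_mem (hd : 0 < d) (hβ : 0 < β) {p : 𝓓} (hp : p.IsNondegenerate)
    {t : ℝ} (htI : t ∈ Set.Icc t₀ t₁) :
    p.approxFrame t ∈ Matrix.specialOrthogonalGroup (Fin 3) ℝ :=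
  mul_mem (R_mem _) (S_mem (hp.cross_pos hd hβ htI))

theorem transpose_mem {A : M3} (hA : A ∈ Matrix.specialOrthogonalGroup (Fin 3) ℝ) :
    Aᵀ ∈ Matrix.specialOrthogonalGroup (Fin 3) ℝ := by
  rw [Matrix.mem_specialOrthogonalGroup_iff] at *
  refine ⟨(Matrix.mem_orthogonalGroup_iff' (Fin 3) ℝ).2 ?_, by rw [Matrix.det_transpose, hA.2]⟩
  simpa using (Matrix.mem_orthogonalGroup_iff (Fin 3) ℝ).1 hA.1

theorem approxCurve_mem (ht : t₀ < t₁) (hd : 0 < d) (hβ : 0 < β) {p : 𝓓}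
    (hp : p.IsNondegenerate) {g : M3} (hg : g ∈ Matrix.specialOrthogonalGroup (Fin 3) ℝ)
    {t : ℝ} (htI : t ∈ Set.Icc t₀ t₁) :
    p.approxCurve g t ∈ Matrix.specialOrthogonalGroup (Fin 3) ℝ :=
  mul_mem (mul_mem hg (transpose_mem (approxFrame_mem hd hβ hp (Set.left_mem_Icc.2 ht.le))))
    (approxFrame_mem hd hβ hp htI)

theorem approxCurve_initial (ht : t₀ < t₁) (hd : 0 < d) (hβ : 0 < β) {p : 𝓓}
    (hp : p.IsNondegenerate) (g : M3) : p.approxCurve g t₀ = g := by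
  have h := approxFrame_mem hd hβ hp (Set.left_mem_Icc.2 ht.le)
  have h1 : (p.approxFrame t₀)ᵀ * p.approxFrame t₀ = 1 :=
    (Matrix.mem_orthogonalGroup_iff' (Fin 3) ℝ).1 (Matrix.mem_specialOrthogonalGroup_iff.1 h).1
  rw [approxCurve, Matrix.mul_assoc, h1, Matrix.mul_one]

theorem hasMatrixDerivWithinAt_approxCurve (hd : 0 < d) (hβ : 0 < β) {p : 𝓓}
    (hp : p.IsNondegenerate) (g : M3) {t : ℝ} (htI : t ∈ Set.Icc t₀ t₁) :
    HasMatrixDerivWithinAt (p.approxCurve g) (p.approxCurve g t * ad (p.approxVelocity t))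
      (Set.Icc t₀ t₁) t := by
  have h := hasMatrixDerivWithinAt_frame (p.hasDerivWithinAt_acc hd.ne' (Set.Icc t₀ t₁) t)
    (p.hasDerivWithinAt_acc' hd.ne' (Set.Icc t₀ t₁) t) (hp.cross_pos hd hβ htI)
    (p.hasDerivAt_phase hd.ne' hβ.ne' t).hasDerivWithinAt
  have h2 := h.const_mul (g * (p.approxFrame t₀)ᵀ)
  rwa [← Matrix.mul_assoc] at h2

/-- A small datum together with a curve in `SO(3)` whose left Lie reduction is the Lie quadratic
of the datum. -/
structure Motion (t₀ t₁ d a₁₁ a₁₂ β c₂ M δ₀ : ℝ) where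
  datum : Small t₀ t₁ d a₁₁ a₁₂ β c₂ M δ₀
  x : ℝ → M3
  mem : ∀ t ∈ Set.Icc t₀ t₁, x t ∈ Matrix.specialOrthogonalGroup (Fin 3) ℝ
  deriv : ∀ t ∈ Set.Icc t₀ t₁,
    HasMatrixDerivWithinAt x (x t * ad (datum.1.V t)) (Set.Icc t₀ t₁) t

theorem Small.isNondegenerate (hδ₀ : ∀ p : 𝓓, p.ε < δ₀ → p.IsNondegenerate)
    (q : Small t₀ t₁ d a₁₁ a₁₂ β c₂ M δ₀) : q.1.IsNondegenerate :=
  hδ₀ q.1 (by rw [ε, abs_of_pos q.2.1]; exact q.2.2)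

theorem vBigO_approxVelocity (ht : t₀ < t₁) (hd : 0 < d) (hβ : 0 < β)
    (hδ₀ : ∀ p : 𝓓, p.ε < δ₀ → p.IsNondegenerate) :
    VBigO (Set.Icc t₀ t₁) (fun q : Small t₀ t₁ d a₁₁ a₁₂ β c₂ M δ₀ => q.1.ε) 0
      (fun q => q.1.approxVelocity) :=
  (((vBigO_frameVelocity_sub ht hd hβ hδ₀).weaken (fun q => q.1.ε_mem) (Nat.zero_le 2)).add
    ((vBigO_V ht).reindex Subtype.val)).congr fun q t _ => by simp [approxVelocity]

local notation "𝓜" => Motion t₀ t₁ d a₁₁ a₁₂ β c₂ M δ₀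

theorem Motion.vBigO_V (ht : t₀ < t₁) :
    VBigO (Set.Icc t₀ t₁) (fun m : 𝓜 => m.datum.1.ε) 0 (fun m => m.datum.1.V) :=
  (Datum.vBigO_V ht).reindex fun m : 𝓜 => m.datum.1

theorem Motion.vBigO_approxVelocity (ht : t₀ < t₁) (hd : 0 < d) (hβ : 0 < β)
    (hδ₀ : ∀ p : 𝓓, p.ε < δ₀ → p.IsNondegenerate) :
    VBigO (Set.Icc t₀ t₁) (fun m : 𝓜 => m.datum.1.ε) 0 (fun m => m.datum.1.approxVelocity) :=
  (Datum.vBigO_approxVelocity ht hd hβ hδ₀).reindex fun m : 𝓜 => m.datum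

theorem Motion.vBigO_approxVelocity_sub (ht : t₀ < t₁) (hd : 0 < d) (hβ : 0 < β)
    (hδ₀ : ∀ p : 𝓓, p.ε < δ₀ → p.IsNondegenerate) :
    VBigO (Set.Icc t₀ t₁) (fun m : 𝓜 => m.datum.1.ε) 2
      (fun m t => m.datum.1.approxVelocity t - m.datum.1.V t) :=
  (vBigO_frameVelocity_sub ht hd hβ hδ₀).reindex fun m : 𝓜 => m.datum

theorem Motion.approxCurve_mem (ht : t₀ < t₁) (hd : 0 < d) (hβ : 0 < β)
    (hδ₀ : ∀ p : 𝓓, p.ε < δ₀ → p.IsNondegenerate) (m : 𝓜) :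
    ∀ t ∈ Set.Icc t₀ t₁, m.datum.1.approxCurve (m.x t₀) t ∈
      Matrix.specialOrthogonalGroup (Fin 3) ℝ := fun _ htI =>
  Datum.approxCurve_mem ht hd hβ (m.datum.isNondegenerate hδ₀)
    (m.mem t₀ (Set.left_mem_Icc.2 ht.le)) htI

theorem Motion.hasMatrixDerivWithinAt_approxCurve (hd : 0 < d) (hβ : 0 < β)
    (hδ₀ : ∀ p : 𝓓, p.ε < δ₀ → p.IsNondegenerate) (m : 𝓜) :
    ∀ t ∈ Set.Icc t₀ t₁, HasMatrixDerivWithinAt (m.datum.1.approxCurve (m.x t₀))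
      (m.datum.1.approxCurve (m.x t₀) t * ad (m.datum.1.approxVelocity t))
      (Set.Icc t₀ t₁) t := fun _ htI =>
  Datum.hasMatrixDerivWithinAt_approxCurve hd hβ (m.datum.isNondegenerate hδ₀) _ htI

theorem Motion.bigO_sub (ht : t₀ < t₁) (hd : 0 < d) (hβ : 0 < β)
    (hδ₀ : ∀ p : 𝓓, p.ε < δ₀ → p.IsNondegenerate) (i k : Fin 3) :
    BigO (Set.Icc t₀ t₁) (fun m : 𝓜 => m.datum.1.ε) 2
      (fun m t => m.x t i k - m.datum.1.approxCurve (m.x t₀) t i k) :=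
  bigO_sub_of_reduction (x := fun m : 𝓜 => m.x)
    (y := fun m : 𝓜 => m.datum.1.approxCurve (m.x t₀)) (v := fun m => m.datum.1.V)
    (w := fun m => m.datum.1.approxVelocity) ht (fun m => m.mem)
    (Motion.approxCurve_mem ht hd hβ hδ₀) (fun m => m.deriv)
    (Motion.hasMatrixDerivWithinAt_approxCurve hd hβ hδ₀)
    (fun m => (approxCurve_initial ht hd hβ (m.datum.isNondegenerate hδ₀) _).symm)
    (Motion.vBigO_V ht) (Motion.vBigO_approxVelocity ht hd hβ hδ₀)
    (Motion.vBigO_approxVelocity_sub ht hd hβ hδ₀) i k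

theorem Motion.contDiffOn_approxCurve (ht : t₀ < t₁) (hd : 0 < d) (hβ : 0 < β)
    (hδ₀ : ∀ p : 𝓓, p.ε < δ₀ → p.IsNondegenerate) (m : 𝓜) (i k : Fin 3) :
    ContDiffOn ℝ ∞ (fun t => m.datum.1.approxCurve (m.x t₀) t i k) (Set.Icc t₀ t₁) :=
  (vBigO_row (x := fun m : 𝓜 => m.datum.1.approxCurve (m.x t₀))
    (Motion.approxCurve_mem ht hd hβ hδ₀) (Motion.hasMatrixDerivWithinAt_approxCurve hd hβ hδ₀)
    (Motion.vBigO_approxVelocity ht hd hβ hδ₀) i k).contDiffOn (uniqueDiffOn_Icc ht) m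

theorem Motion.contDiffOn_x (ht : t₀ < t₁) (m : 𝓜) (i k : Fin 3) :
    ContDiffOn ℝ ∞ (fun t => m.x t i k) (Set.Icc t₀ t₁) :=
  (vBigO_row (x := fun m : 𝓜 => m.x) (fun m => m.mem) (fun m => m.deriv)
    (Motion.vBigO_V ht) i k).contDiffOn (uniqueDiffOn_Icc ht) m

/-- The uniform error bounds for all derivatives. -/
theorem exists_bound (ht : t₀ < t₁) (hd : 0 < d) (hβ : 0 < β)
    (hδ₀ : ∀ p : 𝓓, p.ε < δ₀ → p.IsNondegenerate) :
    ∃ K : ℕ → ℝ, ∀ (m : 𝓜) (j : ℕ),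
      ∀ t ∈ Set.Icc t₀ t₁, ∀ i k : Fin 3,
        |iteratedDerivWithin j (fun s => m.x s i k) (Set.Icc t₀ t₁) t
          - iteratedDerivWithin j (fun s => m.datum.1.approxCurve (m.x t₀) s i k)
            (Set.Icc t₀ t₁) t| ≤ K j * m.datum.1.h ^ 2 := by
  have hI := uniqueDiffOn_Icc ht
  have h := fun i k j => ((Motion.bigO_sub ht hd hβ hδ₀ i k) j).iteratedDerivWithin_bound hI
  choose K hK using h
  refine ⟨fun j => ∑ i, ∑ k, |K i k j|, fun m j t htI i k => ?_⟩
  have h1 := hK i k j m t htI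
  have h2 : iteratedDerivWithin j (fun s => m.x s i k - m.datum.1.approxCurve (m.x t₀) s i k)
      (Set.Icc t₀ t₁) t = iteratedDerivWithin j (fun s => m.x s i k) (Set.Icc t₀ t₁) t
          - iteratedDerivWithin j (fun s => m.datum.1.approxCurve (m.x t₀) s i k)
            (Set.Icc t₀ t₁) t :=
    iteratedDerivWithin_sub htI hI ((contDiffOn_infty.1 (m.contDiffOn_x ht i k) j) t htI)
      ((contDiffOn_infty.1 (m.contDiffOn_approxCurve ht hd hβ hδ₀ i k) j) t htI)
  rw [h2, ε, sq_abs] at h1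
  refine h1.trans (mul_le_mul_of_nonneg_right ((le_abs_self _).trans ?_) (sq_nonneg _))
  exact (Finset.single_le_sum (f := fun k => |K i k j|) (fun _ _ => abs_nonneg _)
    (Finset.mem_univ k)).trans (Finset.single_le_sum (f := fun i => ∑ k, |K i k j|)
      (fun _ _ => Finset.sum_nonneg fun _ _ => abs_nonneg _) (Finset.mem_univ i))

variable {V : ℝ → ℝ → E3}

theorem accel2_eq_acc (ht : t₀ < t₁) (hd : d ≠ 0) (p : 𝓓)
    (h0 : ∀ t ∈ Set.Icc t₀ t₁, V 0 t = d • p.F₀)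
    (hv : ∀ t ∈ Set.Icc t₀ t₁,
      iteratedDerivWithin 1 (fun h => V h t) (Set.Icc (-1) 1) 0 = p.U t ∧
      iteratedDerivWithin 2 (fun h => V h t) (Set.Icc (-1) 1) 0 = p.Z t)
    {t : ℝ} (htI : t ∈ Set.Icc t₀ t₁) : accel2 t₀ t₁ V p.h t = p.h • p.acc t := by
  rw [p.accel2_eq ht hd h0 hv p.h htI, acc]
  module

theorem derivWithin_accel2_eq_acc' (ht : t₀ < t₁) (hd : d ≠ 0) (p : 𝓓)
    (h0 : ∀ t ∈ Set.Icc t₀ t₁, V 0 t = d • p.F₀)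
    (hv : ∀ t ∈ Set.Icc t₀ t₁,
      iteratedDerivWithin 1 (fun h => V h t) (Set.Icc (-1) 1) 0 = p.U t ∧
      iteratedDerivWithin 2 (fun h => V h t) (Set.Icc (-1) 1) 0 = p.Z t)
    {t : ℝ} (htI : t ∈ Set.Icc t₀ t₁) :
    derivWithin (accel2 t₀ t₁ V p.h) (Set.Icc t₀ t₁) t = p.h • p.acc' t := by
  rw [derivWithin_congr (fun s hs => p.accel2_eq_acc ht hd h0 hv hs)
    (p.accel2_eq_acc ht hd h0 hv htI)]
  exact ((p.hasDerivWithinAt_acc hd _ t).const_smul p.h).derivWithin (uniqueDiffOn_Icc ht t htI)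

/-- On the interval, the curve `xHat` is the approximate curve: `acc` and `acc'` differ from the
derivatives of the approximate quadratic by the factor `h`, which `S` does not see. -/
theorem xHat_eq_approxCurve (ht : t₀ < t₁) (hd : d ≠ 0) (p : 𝓓) (hh : 0 < p.h)
    (h0 : ∀ t ∈ Set.Icc t₀ t₁, V 0 t = d • p.F₀)
    (hv : ∀ t ∈ Set.Icc t₀ t₁,
      iteratedDerivWithin 1 (fun h => V h t) (Set.Icc (-1) 1) 0 = p.U t ∧
      iteratedDerivWithin 2 (fun h => V h t) (Set.Icc (-1) 1) 0 = p.Z t)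
    (x : ℝ → M3) {t : ℝ} (htI : t ∈ Set.Icc t₀ t₁) :
    xHat t₀ t₁ V p.h (phase t₀ d a₁₁ a₁₂ β p.γ c₂ p.h) x t = p.approxCurve (x t₀) t := by
  have key : ∀ s ∈ Set.Icc t₀ t₁,
      yHat t₀ t₁ V p.h (phase t₀ d a₁₁ a₁₂ β p.γ c₂ p.h) s = p.approxFrame s := by
    intro s hs
    rw [yHat, T, p.derivWithin_accel2_eq_acc' ht hd h0 hv hs, p.accel2_eq_acc ht hd h0 hv hs,
      S_smul hh, approxFrame]
  rw [xHat, key t htI, key t₀ (Set.left_mem_Icc.2 ht.le), approxCurve]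

theorem linearIndependent_accel2 (ht : t₀ < t₁) (hd : 0 < d) (hβ : 0 < β) {p : 𝓓}
    (hp : p.IsNondegenerate) (hh : 0 < p.h)
    (h0 : ∀ t ∈ Set.Icc t₀ t₁, V 0 t = d • p.F₀)
    (hv : ∀ t ∈ Set.Icc t₀ t₁,
      iteratedDerivWithin 1 (fun h => V h t) (Set.Icc (-1) 1) 0 = p.U t ∧
      iteratedDerivWithin 2 (fun h => V h t) (Set.Icc (-1) 1) 0 = p.Z t)
    {t : ℝ} (htI : t ∈ Set.Icc t₀ t₁) : LinearIndependent ℝ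
      ![accel2 t₀ t₁ V p.h t, derivWithin (accel2 t₀ t₁ V p.h) (Set.Icc t₀ t₁) t] := by
  rw [p.derivWithin_accel2_eq_acc' ht hd.ne' h0 hv htI, p.accel2_eq_acc ht hd.ne' h0 hv htI,
    ← crossProduct_ne_zero_iff_linearIndependent]
  intro h
  have h1 := hp.cross_pos hd hβ htI
  have h2 : p.acc t ⨯₃ p.acc' t = 0 := by
    simpa [smul_smul, hh.ne'] using h
  rw [h2] at h1
  simp at h1

end Datum

end NearlyGeodesicCubic

open NearlyGeodesicCubic in
theorem theorem4 (t₀ t₁ d a₁₁ a₁₂ β c₂ M : ℝ) (ht : t₀ < t₁) (hd : 0 < d) (hβ : 0 < β) :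
    ∃ δ₀ : ℝ, 0 < δ₀ ∧ δ₀ ≤ 1 ∧ ∃ K : ℕ → ℝ,
      ∀ (c₀ c₁ a₀₁ a₀₂ γ : ℝ), |c₀| ≤ M → |c₁| ≤ M → |a₀₁| ≤ M → |a₀₂| ≤ M →
      ∀ (D F₀ F₁ F₂ A₀ A₁ B : E3),
        len D = d → F₀ = d⁻¹ • D → len F₁ = 1 → F₀ ⬝ᵥ F₁ = 0 → F₂ = F₀ ⨯₃ F₁ →
        A₀ = a₀₁ • F₁ + a₀₂ • F₂ → A₁ = a₁₁ • F₁ + a₁₂ • F₂ →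
        B = (β * Real.cos γ) • F₁ + (β * Real.sin γ) • F₂ →
      ∀ V : ℝ → ℝ → E3, IsVariation t₀ t₁ D V →
        HasAffineInitialJet t₀ t₁ V D
          (c₀ • F₀ + A₀ + B) (c₁ • F₀ + A₁ - d • (F₀ ⨯₃ B)) ((2 * c₂) • F₀ - d ^ 2 • B) →
      (∀ δ : ℝ, ∀ t ∈ Set.Icc t₀ t₁,
        approxQuadratic V 1 δ t = D + δ • firstVar t₀ d c₀ c₁ c₂ F₀ A₀ A₁ B t ∧
        accel2 t₀ t₁ V δ t = approxAccel t₀ d c₀ c₁ c₂ F₀ A₀ A₁ B δ t) ∧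
      ∀ δ : ℝ, 0 < δ → δ < δ₀ →
        (∀ t ∈ Set.Icc t₀ t₁, LinearIndependent ℝ
          ![accel2 t₀ t₁ V δ t, derivWithin (accel2 t₀ t₁ V δ) (Set.Icc t₀ t₁) t]) ∧
        ∀ x : ℝ → M3, IsRiemannianCubic t₀ t₁ x → IsLeftLieReduction t₀ t₁ x (V δ) →
        ∀ xh : ℝ → M3, xh = xHat t₀ t₁ V δ (phase t₀ d a₁₁ a₁₂ β γ c₂ δ) x →
          (∀ t ∈ Set.Icc t₀ t₁, xh t ∈ Matrix.specialOrthogonalGroup (Fin 3) ℝ) ∧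
          SmoothCurve (Set.Icc t₀ t₁) xh ∧
          ∀ (j : ℕ), ∀ t ∈ Set.Icc t₀ t₁, ∀ i k : Fin 3,
            |iteratedDerivWithin j (fun s => x s i k) (Set.Icc t₀ t₁) t
              - iteratedDerivWithin j (fun s => xh s i k) (Set.Icc t₀ t₁) t| ≤ K j * δ ^ 2 := by
  obtain ⟨δ₀, hδ, hδ1, hδ₀⟩ := Datum.exists_nondegenerate (a₁₁ := a₁₁) (a₁₂ := a₁₂) (c₂ := c₂)
    (M := M) ht hd hβ
  obtain ⟨K, hK⟩ := Datum.exists_bound ht hd hβ hδ₀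
  refine ⟨δ₀, hδ, hδ1, K, ?_⟩
  intro c₀ c₁ a₀₁ a₀₂ γ hc₀ hc₁ ha₀₁ ha₀₂ D F₀ F₁ F₂ A₀ A₁ B hD hF₀ hF₁ h₀₁ hF₂ hA₀ hA₁ hB
    V hV hjet
  obtain rfl : D = d • F₀ := by rw [hF₀, smul_inv_smul₀ hd.ne']
  subst hF₂ hA₀ hA₁ hB
  clear hF₀
  have h₀ : F₀ ⬝ᵥ F₀ = 1 := by
    rw [len_smul hd.le] at hD
    exact len_eq_one_iff.1 (mul_left_cancel₀ hd.ne' (by rw [hD, mul_one]))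
  have h₁ : F₁ ⬝ᵥ F₁ = 1 := len_eq_one_iff.1 hF₁
  obtain ⟨hsmooth, hquad, hV0⟩ := hV
  have h02 := cross_frame_zero_two h₀ h₀₁
  -- Only `h` and `V` vary with `s`, so the variations `U` and `Z` of all `P s` agree by `rfl`.
  let P : Set.Icc (-1 : ℝ) 1 → Datum t₀ t₁ d a₁₁ a₁₂ β c₂ M := fun s =>
    { h := s, c₀ := c₀, c₁ := c₁, a₀₁ := a₀₁, a₀₂ := a₀₂, γ := γ, F₀ := F₀, F₁ := F₁, V := V s
      abs_h := abs_le.2 s.2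
      abs_c₀ := hc₀, abs_c₁ := hc₁, abs_a₀₁ := ha₀₁, abs_a₀₂ := ha₀₂
      dot₀ := h₀, dot₁ := h₁, dot₀₁ := h₀₁
      quadratic := hquad s s.2
      init₀ := by rw [(hjet s s.2).1, frame]; module
      init₁ := by
        rw [(hjet s s.2).2.1, frame, map_add, map_smul, map_smul, h02]; module
      init₂ := by rw [(hjet s s.2).2.2, frame]; module }
  let p₀ : Datum t₀ t₁ d a₁₁ a₁₂ β c₂ M := P ⟨0, by constructor <;> norm_num⟩
  have hv : ∀ t ∈ Set.Icc t₀ t₁,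
      iteratedDerivWithin 1 (fun h => V h t) (Set.Icc (-1) 1) 0 = p₀.U t ∧
      iteratedDerivWithin 2 (fun h => V h t) (Set.Icc (-1) 1) 0 = p₀.Z t := fun t htI =>
    Datum.variation_eq ht hd.ne' hsmooth P (fun _ => rfl) (fun _ => rfl) (fun _ => rfl)
      (fun _ => rfl) (fun _ => rfl) htI
  have hfr : ∀ a b : ℝ, a • F₁ + b • (F₀ ⨯₃ F₁) = p₀.fr 0 a b := fun a b => by
    change _ = frame F₀ F₁ 0 a b
    rw [frame, zero_smul, zero_add]
  refine ⟨fun δ t htI => ⟨?_, ?_⟩, fun δ hδpos hδlt => ?_⟩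
  · rw [hfr, hfr, hfr, approxQuadratic, Finset.Icc_self, Finset.sum_singleton, hV0 t htI,
      (hv t htI).1, ← p₀.firstVar_eq t]
    simp [p₀, P]
  · rw [hfr, hfr, hfr, p₀.accel2_eq ht hd.ne' hV0 hv δ htI]
    exact (p₀.approxAccel_eq δ t).symm
  · let p : Datum t₀ t₁ d a₁₁ a₁₂ β c₂ M := P ⟨δ, by linarith, by linarith⟩
    let q : Datum.Small t₀ t₁ d a₁₁ a₁₂ β c₂ M δ₀ := ⟨p, hδpos, hδlt⟩
    have hp : p.IsNondegenerate := Datum.Small.isNondegenerate hδ₀ q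
    refine ⟨fun t htI => Datum.linearIndependent_accel2 (p := p) ht hd hβ hp hδpos hV0 hv htI,
      fun x hx hxV xh hxh => ?_⟩
    let m : Datum.Motion t₀ t₁ d a₁₁ a₁₂ β c₂ M δ₀ :=
      ⟨q, x, hx.1, isRiemannianCubic_reduction hx hxV⟩
    have hxh' : ∀ t ∈ Set.Icc t₀ t₁, xh t = p.approxCurve (x t₀) t := fun t htI => by
      rw [hxh]; exact p.xHat_eq_approxCurve ht hd.ne' hδpos hV0 hv x htI
    refine ⟨fun t htI => ?_, fun i k => ?_, fun j t htI i k => ?_⟩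
    · rw [hxh' t htI]
      exact Datum.Motion.approxCurve_mem ht hd hβ hδ₀ m t htI
    · exact (Datum.Motion.contDiffOn_approxCurve ht hd hβ hδ₀ m i k).congr fun t htI => by
        rw [hxh' t htI]
    · rw [iteratedDerivWithin_congr (f := fun s => xh s i k)
        (g := fun s => p.approxCurve (x t₀) s i k) (fun s hs => by
          simp only [hxh' s hs]) htI]
      exact hK m j t htI i k
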